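/- Let $V$ be a complex inner product space of dimension $2$, and let $G$ be a group acting on $V$ by unitary maps (for example, a compact Lie group with a unitary representation on $V$). Let $s(V)$ be the space of selfadjoint endomorphisms of $V$, let $\mathcal{L}(V,V)$ be the space of isometric linear maps $V\to V$, and let $F_1=\{\varphi\in\mathcal{L}(V,V):\operatorname{rank}(\varphi-I)\le 1\}$. For $\alpha\in s(V)$ with eigenvalues $e_0(\alpha)\le e_1(\alpha)$ put $P_1(\alpha)=\operatorname{Ker}(\alpha-e_0(\alpha))^{\perp}$. Let $\tilde X_1'$ be the set of pairs $(\alpha,\theta)$ with $\alpha\in s(V)$ and $\theta:P_1(\alpha)\to V$ a linear isometric map, with the quotient topology from the surjection $s(V)\times\mathcal{L}(V,V)\to\tilde X_1'$, $(\alpha,\varphi)\mapsto(\alpha,\varphi|_{P_1(\alpha)})$. The group $G$ acts on all these spaces by conjugation. Write $Y_\infty$ for the one-point compactification of $Y$, based at the added ($G$-fixed) point, and put $\tilde X_1=(\tilde X_1')_\infty$. Let $$res_1:S^{s(V)}\wedge (F_1)_\infty=(s(V)\times F_1)_\infty\to\tilde X_1,\qquad (\alpha,\varphi)\mapsto(\alpha,\varphi|_{P_1(\alpha)}),\quad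 \infty\mapsto\infty .$$ For $\theta:P_1(\alpha)\to V$ let $\theta_{1}:P_1(\alpha)\to P_1(\alpha)$ be the composite of $\theta$ with the orthogonal projection onto $P_1(\alpha)$, and for $\varphi\in\mathcal L(V,V)$ let $\varphi_{11}=(\varphi|_{P_1(\alpha)})_1$. Let $$A=\{(\alpha,\varphi)\in s(V)\times F_1:\dim P_1(\alpha)=1,\ \varphi_{11}-I\text{ invertible}\},$$ $$B=\{(\alpha,\theta)\in\tilde X_1':\dim P_1(\alpha)=1,\ \theta_{1}-I\text{ invertible}\},$$ and let $$res_1':\big((s(V)\times F_1)\setminus A\big)_\infty\to(\tilde X_1'\setminus B)_\infty$$ be the restriction of $res_1$. Then $res_1'$ and $res_1$ are based $G$-homotopy equivalences: each is a continuous based $G$-map with a based $G$-homotopy inverse, where all homotopies are through based $G$-maps. -/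

import Mathlib

noncomputable section

namespace MillerTower

open scoped OnePoint

section Spaces

variable (V : Type*) [NormedAddCommGroup V] [InnerProductSpace ℂ V]

/-- `s(V)`: the space of selfadjoint endomorphisms of `V`, with the operator norm topology. -/
abbrev SelfAdj : Type _ := {α : V →L[ℂ] V // (α : V →ₗ[ℂ] V).IsSymmetric}

/-- `𝓛(V, V)`: the space of isometric linear maps `V → V`, with the operator norm topology. -/
abbrev Isom : Type _ := {φ : V →L[ℂ] V // ∀ x, ‖φ x‖ = ‖x‖}

/-- The stage `F_k = {φ ∈ 𝓛(V, V) : rank (φ - I) ≤ k}` of the Miller filtration. -/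
abbrev Filt (k : ℕ) : Type _ :=
  {φ : Isom V // Module.finrank ℂ (LinearMap.range ((φ.1 - 1 : V →L[ℂ] V) : V →ₗ[ℂ] V)) ≤ k}

variable {V}

/-- An element of `𝓛(V, V)` restricted to a subspace. -/
def Isom.restrict (φ : Isom V) (P : Submodule ℂ V) : P →ₗᵢ[ℂ] V :=
  LinearIsometry.comp ⟨(φ.1 : V →ₗ[ℂ] V), φ.2⟩ P.subtypeₗᵢ

variable [FiniteDimensional ℂ V]

/-- `e_j(α)`: the eigenvalues of `α`, with multiplicity, in increasing order
`e_0(α) ≤ e_1(α) ≤ …` (Mathlib lists them in decreasing order). -/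
def eig (α : SelfAdj V) (j : Fin (Module.finrank ℂ V)) : ℝ :=
  α.2.eigenvalues rfl j.rev

/-- `P_k(α)`: the orthogonal complement of the sum of the eigenspaces `Ker (α - e_j(α))`
with `j + k < dim V`. -/
def topSpace (k : ℕ) (α : SelfAdj V) : Submodule ℂ V :=
  (⨆ j : Fin (Module.finrank ℂ V), ⨆ _ : (j : ℕ) + k < Module.finrank ℂ V,
    Module.End.eigenspace (α.1 : V →ₗ[ℂ] V) (eig α j : ℂ))ᗮ

variable (V) in
/-- The space `X̃'_k` of pairs `(α, θ)` with `α ∈ s(V)` and `θ : P_k(α) → V` isometric. -/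
structure XTilde (k : ℕ) where
  base : SelfAdj V
  iso : topSpace k base →ₗᵢ[ℂ] V

/-- The surjection `s(V) × 𝓛(V, V) → X̃'_k`, `(α, φ) ↦ (α, φ|_{P_k(α)})`. -/
def restrictTop (k : ℕ) (p : SelfAdj V × Isom V) : XTilde V k :=
  ⟨p.1, p.2.restrict (topSpace k p.1)⟩

/-- `X̃'_k` has the quotient topology from `s(V) × 𝓛(V, V)`. -/
instance (k : ℕ) : TopologicalSpace (XTilde V k) :=
  TopologicalSpace.coinduced (restrictTop k) inferInstance

/-- The unbased map `s(V) × F_k → X̃'_k`, `(α, φ) ↦ (α, φ|_{P_k(α)})`. -/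
def resUnbased (k : ℕ) (p : SelfAdj V × Filt V k) : XTilde V k :=
  restrictTop k (p.1, p.2.1)

/-- For `θ : P_k(α) → V`, the component `P_k(α) → P_k(α)` of `θ` with respect to the
decomposition `V = P_k(α) ⊕ P_k(α)ᗮ`. -/
def firstBlock {k : ℕ} {α : SelfAdj V} (θ : topSpace k α →ₗᵢ[ℂ] V) :
    topSpace k α →ₗ[ℂ] topSpace k α :=
  ((topSpace k α).orthogonalProjectionOnto : V →ₗ[ℂ] topSpace k α) ∘ₗ θ.toLinearMap

variable (V) in
/-- `A = {(α, φ) ∈ s(V) × F_k : dim P_k(α) = k and φ₁₁ - I is invertible}`, where `φ₁₁` is the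
`P_k(α) → P_k(α)` component of `φ`. -/
def setA (k : ℕ) : Set (SelfAdj V × Filt V k) :=
  {p | Module.finrank ℂ (topSpace k p.1) = k ∧
    IsUnit (firstBlock (p.2.1.restrict (topSpace k p.1)) - 1)}

variable (V) in
/-- `B = {(α, θ) ∈ X̃'_k : dim P_k(α) = k and θ₁ - I is invertible}`, where `θ₁` is the
`P_k(α) → P_k(α)` component of `θ`. -/
def setB (k : ℕ) : Set (XTilde V k) :=
  {x | Module.finrank ℂ (topSpace k x.base) = k ∧ IsUnit (firstBlock x.iso - 1)}

end Spaces

/-! The actions of the unitary group `V ≃ₗᵢ[ℂ] V` by conjugation. -/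

section Actions

variable {V : Type*} [NormedAddCommGroup V] [InnerProductSpace ℂ V]

/-- The conjugate `g ∘ a ∘ g⁻¹`. -/
def conj (g : V ≃ₗᵢ[ℂ] V) (a : V →L[ℂ] V) : V →L[ℂ] V :=
  (g : V →L[ℂ] V) ∘L a ∘L (g.symm : V →L[ℂ] V)

@[simp] theorem conj_apply (g : V ≃ₗᵢ[ℂ] V) (a : V →L[ℂ] V) (x : V) :
    conj g a x = g (a (g.symm x)) := rfl

theorem conj_one (a : V →L[ℂ] V) : conj 1 a = a := rfl

theorem conj_mul (g h : V ≃ₗᵢ[ℂ] V) (a : V →L[ℂ] V) :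
    conj (g * h) a = conj g (conj h a) := rfl

instance : MulAction (V ≃ₗᵢ[ℂ] V) (SelfAdj V) where
  smul g α := ⟨conj g α.1, fun x y => by
    have h := α.2 (g.symm x) (g.symm y)
    simp only [ContinuousLinearMap.coe_coe, conj_apply] at h ⊢
    rw [← g.symm.inner_map_map, ← g.symm.inner_map_map x]
    simpa using h⟩
  one_smul _ := rfl
  mul_smul _ _ _ := rfl

instance : MulAction (V ≃ₗᵢ[ℂ] V) (Isom V) where
  smul g φ := ⟨conj g φ.1, fun x => by simp [φ.2]⟩
  one_smul _ := rfl
  mul_smul _ _ _ := rfl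

theorem SelfAdj.coe_smul (g : V ≃ₗᵢ[ℂ] V) (α : SelfAdj V) : (g • α).1 = conj g α.1 := rfl

theorem Isom.coe_smul (g : V ≃ₗᵢ[ℂ] V) (φ : Isom V) : (g • φ).1 = conj g φ.1 := rfl

theorem range_conj_sub_one (g : V ≃ₗᵢ[ℂ] V) (a : V →L[ℂ] V) :
    LinearMap.range ((conj g a - 1 : V →L[ℂ] V) : V →ₗ[ℂ] V) =
      (LinearMap.range ((a - 1 : V →L[ℂ] V) : V →ₗ[ℂ] V)).map
        (g.toLinearEquiv : V →ₗ[ℂ] V) := by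
  ext y
  simp only [LinearMap.mem_range, Submodule.mem_map]
  constructor
  · rintro ⟨x, rfl⟩
    exact ⟨_, ⟨g.symm x, rfl⟩, by simp⟩
  · rintro ⟨_, ⟨x, rfl⟩, rfl⟩
    exact ⟨g x, by simp⟩

instance (k : ℕ) : MulAction (V ≃ₗᵢ[ℂ] V) (Filt V k) where
  smul g φ := ⟨g • φ.1, by
    rw [Isom.coe_smul, range_conj_sub_one, LinearEquiv.finrank_map_eq]
    exact φ.2⟩
  one_smul _ := rfl
  mul_smul _ _ _ := rfl

theorem eigenspace_smul (g : V ≃ₗᵢ[ℂ] V) (α : SelfAdj V) (μ : ℂ) :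
    Module.End.eigenspace ((g • α).1 : V →ₗ[ℂ] V) μ =
      (Module.End.eigenspace (α.1 : V →ₗ[ℂ] V) μ).map (g.toLinearEquiv : V →ₗ[ℂ] V) := by
  ext y
  simp only [Submodule.mem_map, Module.End.mem_eigenspace_iff]
  constructor
  · intro h
    refine ⟨g.symm y, ?_, by simp⟩
    apply g.injective
    simpa [SelfAdj.coe_smul] using h
  · rintro ⟨x, hx, rfl⟩
    simp only [ContinuousLinearMap.coe_coe] at hx
    simp [SelfAdj.coe_smul, hx]

variable [FiniteDimensional ℂ V]

theorem eig_smul (g : V ≃ₗᵢ[ℂ] V) (α : SelfAdj V) (j : Fin (Module.finrank ℂ V)) :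
    eig (g • α) j = eig α j := by
  have h : (g • α).2.eigenvalues rfl = α.2.eigenvalues rfl := by
    rw [LinearMap.IsSymmetric.eigenvalues_eq_eigenvalues_iff]
    exact LinearEquiv.charpoly_conj g.toLinearEquiv (α.1 : V →ₗ[ℂ] V)
  simp only [eig, h]

/-- `P_k(g • α) = g P_k(α)`. -/
theorem mem_topSpace_smul (g : V ≃ₗᵢ[ℂ] V) (k : ℕ) (α : SelfAdj V) (x : V) :
    x ∈ topSpace k (g • α) ↔ g.symm x ∈ topSpace k α := by
  simp only [topSpace, eig_smul, eigenspace_smul, ← Submodule.map_iSup,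
    Submodule.mem_orthogonal, Submodule.mem_map, forall_exists_index, and_imp,
    forall_apply_eq_imp_iff₂]
  refine forall₂_congr fun y _ => ?_
  rw [← g.symm.inner_map_map]
  simp

/-- The identification `P_k(g • α) ≃ P_k(α)` given by `g⁻¹`. -/
def topSpaceEquiv (g : V ≃ₗᵢ[ℂ] V) (k : ℕ) (α : SelfAdj V) :
    topSpace k (g • α) ≃ₗᵢ[ℂ] topSpace k α where
  toFun x := ⟨g.symm x, (mem_topSpace_smul g k α x).1 x.2⟩
  invFun x := ⟨g x, (mem_topSpace_smul g k α _).2 (by simp)⟩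
  map_add' x y := by ext; simp
  map_smul' c x := by ext; simp
  left_inv x := by ext; simp
  right_inv x := by ext; simp
  norm_map' x := by
    change ‖g.symm (x : V)‖ = ‖(x : V)‖
    simp

theorem XTilde.ext' {k : ℕ} {x y : XTilde V k} (h : x.base = y.base)
    (h' : ∀ (v : V) (hx : v ∈ topSpace k x.base) (hy : v ∈ topSpace k y.base),
      x.iso ⟨v, hx⟩ = y.iso ⟨v, hy⟩) : x = y := by
  obtain ⟨α, θ⟩ := x
  obtain ⟨β, η⟩ := y
  obtain rfl : α = β := h
  congr 1
  ext ⟨v, hv⟩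
  exact h' v hv hv

/-- The action `g • (α, θ) = (g α g⁻¹, g θ g⁻¹)` on `X̃'_k`. -/
instance (k : ℕ) : SMul (V ≃ₗᵢ[ℂ] V) (XTilde V k) where
  smul g x := ⟨g • x.base,
    g.toLinearIsometry.comp (x.iso.comp (topSpaceEquiv g k x.base).toLinearIsometry)⟩

theorem XTilde.base_smul {k : ℕ} (g : V ≃ₗᵢ[ℂ] V) (x : XTilde V k) :
    (g • x).base = g • x.base := rfl

theorem XTilde.iso_smul {k : ℕ} (g : V ≃ₗᵢ[ℂ] V) (x : XTilde V k) (v : V)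
    (hv : v ∈ topSpace k (g • x).base) :
    (g • x).iso ⟨v, hv⟩ =
      g (x.iso ⟨g.symm v, (mem_topSpace_smul g k x.base v).1 hv⟩) := rfl

instance (k : ℕ) : MulAction (V ≃ₗᵢ[ℂ] V) (XTilde V k) where
  one_smul x := by
    refine XTilde.ext' (one_smul _ x.base) fun v hx hy => ?_
    rw [XTilde.iso_smul]
    rfl
  mul_smul g h x := by
    refine XTilde.ext' (mul_smul g h x.base) fun v hx hy => ?_
    rw [XTilde.iso_smul, XTilde.iso_smul, XTilde.iso_smul]
    rfl

theorem finrank_topSpace_smul (g : V ≃ₗᵢ[ℂ] V) (k : ℕ) (α : SelfAdj V) :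
    Module.finrank ℂ (topSpace k (g • α)) = Module.finrank ℂ (topSpace k α) :=
  (topSpaceEquiv g k α).toLinearEquiv.finrank_eq

theorem coe_proj_topSpace_smul (g : V ≃ₗᵢ[ℂ] V) (k : ℕ) (α : SelfAdj V) (v : V) :
    ((topSpace k (g • α)).orthogonalProjectionOnto (g v) : V) =
      g ((topSpace k α).orthogonalProjectionOnto v) := by
  have h1 : g ((topSpace k α).orthogonalProjectionOnto v : V) ∈ topSpace k (g • α) :=
    (mem_topSpace_smul g k α _).2 (by simp)
  refine Submodule.eq_starProjection_of_mem_of_inner_eq_zero h1 fun w hw => ?_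
  have h2 := (topSpace k α).starProjection_inner_eq_zero v (g.symm w)
    ((mem_topSpace_smul g k α w).1 hw)
  rw [← h2, ← g.symm.inner_map_map]
  simp

theorem firstBlock_smul {k : ℕ} (g : V ≃ₗᵢ[ℂ] V) (x : XTilde V k) :
    firstBlock (g • x).iso =
      (topSpaceEquiv g k x.base).symm.toLinearEquiv.conj (firstBlock x.iso) := by
  ext v
  exact coe_proj_topSpace_smul g k x.base (x.iso (topSpaceEquiv g k x.base v))

theorem smul_mem_setB_iff {k : ℕ} (g : V ≃ₗᵢ[ℂ] V) (x : XTilde V k) :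
    g • x ∈ setB V k ↔ x ∈ setB V k := by
  refine and_congr (by rw [XTilde.base_smul, finrank_topSpace_smul]) ?_
  have h : firstBlock (g • x).iso - 1 =
      (topSpaceEquiv g k x.base).symm.toLinearEquiv.conjRingEquiv (firstBlock x.iso - 1) := by
    rw [map_sub, map_one, firstBlock_smul]
    rfl
  rw [h, MulEquiv.isUnit_map]

theorem mem_setA_iff {k : ℕ} (p : SelfAdj V × Filt V k) :
    p ∈ setA V k ↔ resUnbased k p ∈ setB V k := Iff.rfl

theorem resUnbased_smul {k : ℕ} (g : V ≃ₗᵢ[ℂ] V) (p : SelfAdj V × Filt V k) :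
    resUnbased k (g • p) = g • resUnbased k p :=
  XTilde.ext' rfl fun _ _ _ => rfl

variable (V) in
/-- The complement of `A` in `s(V) × F_k`, as an invariant subspace. -/
def complA (k : ℕ) : SubMulAction (V ≃ₗᵢ[ℂ] V) (SelfAdj V × Filt V k) where
  carrier := (setA V k)ᶜ
  smul_mem' g p hp := by
    rw [Set.mem_compl_iff, mem_setA_iff, resUnbased_smul, smul_mem_setB_iff]
    exact hp

variable (V) in
/-- The complement of `B` in `X̃'_k`, as an invariant subspace. -/
def complB (k : ℕ) : SubMulAction (V ≃ₗᵢ[ℂ] V) (XTilde V k) where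
  carrier := (setB V k)ᶜ
  smul_mem' g x hx := by
    rw [Set.mem_compl_iff, smul_mem_setB_iff]
    exact hx

/-- The action on a one-point compactification, fixing the base point `∞`. -/
instance {X : Type*} [MulAction (V ≃ₗᵢ[ℂ] V) X] : MulAction (V ≃ₗᵢ[ℂ] V) (OnePoint X) where
  smul g := OnePoint.map (g • ·)
  one_smul x := by
    change OnePoint.map _ x = x
    simp only [one_smul]
    exact congrFun OnePoint.map_id x
  mul_smul g h x := by
    change OnePoint.map _ x = OnePoint.map _ (OnePoint.map _ x)
    rw [← Function.comp_apply (f := OnePoint.map _), ← OnePoint.map_comp]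
    simp only [mul_smul]
    rfl

/-- `res_k : (s(V) × F_k)_∞ → X̃_k = (X̃'_k)_∞`. -/
def res (k : ℕ) : OnePoint (SelfAdj V × Filt V k) → OnePoint (XTilde V k) :=
  OnePoint.map (resUnbased k)

/-- `res'_k : ((s(V) × F_k) ∖ A)_∞ → (X̃'_k ∖ B)_∞`, the restriction of `res_k`. -/
def res' (k : ℕ) : OnePoint (complA V k) → OnePoint (complB V k) :=
  OnePoint.map fun p => ⟨resUnbased k p.1, p.2⟩

end Actions

section Homotopy

variable {V : Type*} [NormedAddCommGroup V] [InnerProductSpace ℂ V]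
  {G : Type*} [Group G] (ρ : G →* (V ≃ₗᵢ[ℂ] V))
  {X Y : Type*} [TopologicalSpace X] [TopologicalSpace Y]
  [MulAction (V ≃ₗᵢ[ℂ] V) X] [MulAction (V ≃ₗᵢ[ℂ] V) Y]

/-- A continuous map of one-point compactifications is a based `G`-map if it preserves `∞` and
commutes with the action of `G` through `ρ`. -/
def IsBasedGMap (f : C(OnePoint X, OnePoint Y)) : Prop :=
  f ∞ = ∞ ∧ ∀ (g : G) (x : OnePoint X), f (ρ g • x) = ρ g • f x

/-- `f` is a based `G`-homotopy equivalence: it is a continuous based `G`-map, and it has an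
inverse up to homotopy through based `G`-maps. -/
def IsBasedGHomotopyEquiv (f : OnePoint X → OnePoint Y) : Prop :=
  ∃ (F : C(OnePoint X, OnePoint Y)) (F' : C(OnePoint Y, OnePoint X)),
    ⇑F = f ∧ IsBasedGMap ρ F ∧ IsBasedGMap ρ F' ∧
    (F'.comp F).HomotopicWith (ContinuousMap.id _) (IsBasedGMap ρ) ∧
    (F.comp F').HomotopicWith (ContinuousMap.id _) (IsBasedGMap ρ)

end Homotopy

end MillerTower

end

noncomputable section

namespace MillerTower

open Module Filter Topology Set
open scoped OnePoint unitInterval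

section

variable {V : Type*} [NormedAddCommGroup V] [InnerProductSpace ℂ V]

/-! ### Rank one projections -/

/-! Write `α = e_0 + d(1 - vv*)` with `d = e_1 - e_0 ≥ 0` and `v` a unit eigenvector for `e_0`.
Every element of `F_1` is `1 - (1 - z)ee*` with `|z| = 1` and `e` a unit vector, so triples `(α, z,
e)` cover `s(V) × F_1`. An isometric map `P_1(α) → V` extends to an element of `F_1`, uniquely
unless it is the inclusion (`resUnbased_surjective`, `Cover.eq_or_mem_complA`). So `res_1` is a
proper surjection, injective on `A`. Off `A`, where `z = 1` or the deviation `D = (α - e_0) - d(1 -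
ee*)` vanishes, it forgets `φ`: its fibre is a circle (`e` on the line of `v`), or all of `F_1` if
`α` is scalar.

These fibres are contracted through `∞`. For fixed `e_0` and `e`, the pairs `(e_0 + t(1 - ee*), z)`
with `t ≥ d` form a punctured disc with polar coordinates `(1 + d)/(1 + t)` and `z`, and `∞` fills
in the centre. The homotopy `slide` moves `z` along a chord of the disc to a point `corner`, which
is `1` when `D = 0` and `z` when `‖D‖ ≥ |1 - z|`, while removing from `α` a part of `D` of norm at
most `|1 - z|`. It starts at the identity, and its end is constant on the fibres of `res_1`, hence
equals `γ ∘ res_1` for some `γ`.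

The homotopy `stretch` ends with the same `α` and radius but keeps `z`. It is stationary off `A`, so
`res_1 ∘ stretch` descends to the target. Its end agrees with that of `res_1 ∘ slide`
(`res_slide_one`): either the angle has not moved, or `D` has been removed and `res_1` no longer
sees the angle. So `res_1 ∘ γ` is homotopic to the identity.

Continuity at `∞` rests on the estimate `Cover.le_norm_push`. Everything commutes with conjugation
and preserves the complement of `A`, which gives equivariance and the case of `res_1'`. -/

/-- The orthogonal projection onto the line spanned by a unit vector `e`. -/
def lineProj (e : V) : V →L[ℂ] V := InnerProductSpace.rankOne ℂ e e

/-- The orthogonal projection onto the complement of the line spanned by a unit vector `e`. -/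
def perpProj (e : V) : V →L[ℂ] V := 1 - lineProj e

@[simp] theorem lineProj_apply (e x : V) : lineProj e x = inner ℂ e x • e := rfl

@[simp] theorem perpProj_apply (e x : V) : perpProj e x = x - inner ℂ e x • e := rfl

theorem inner_self_of_norm_one {e : V} (he : ‖e‖ = 1) : inner ℂ e e = (1 : ℂ) := by
  rw [inner_self_eq_norm_sq_to_K, he]; simp

theorem lineProj_self {e : V} (he : ‖e‖ = 1) : lineProj e e = e := by
  simp [he]

theorem lineProj_ne_zero {e : V} (he : ‖e‖ = 1) : lineProj e ≠ 0 := by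
  intro h
  have := lineProj_self he
  rw [h] at this
  rw [← this] at he
  simp at he

theorem lineProj_comp_perpProj {e : V} (he : ‖e‖ = 1) : lineProj e ∘L perpProj e = 0 := by
  ext x
  simp [he]

theorem perpProj_isSymmetric (e : V) : (perpProj e : V →ₗ[ℂ] V).IsSymmetric := fun x y => by
  simp [inner_sub_left, inner_sub_right, inner_smul_left, inner_smul_right, mul_comm]

theorem real_smul_isSymmetric {T : V →L[ℂ] V} (hT : (T : V →ₗ[ℂ] V).IsSymmetric) (c : ℝ) :
    (((c : ℂ) • T : V →L[ℂ] V) : V →ₗ[ℂ] V).IsSymmetric := fun x y => by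
  have := hT x y
  simp only [ContinuousLinearMap.coe_coe] at this
  simp [-Complex.coe_smul, inner_smul_left, inner_smul_right, this]

theorem conj_lineProj (g : V ≃ₗᵢ[ℂ] V) (e : V) : conj g (lineProj e) = lineProj (g e) := by
  ext x
  rw [conj_apply, lineProj_apply, lineProj_apply, map_smul, ← g.symm.inner_map_map (g e)]
  simp

theorem conj_perpProj (g : V ≃ₗᵢ[ℂ] V) (e : V) : conj g (perpProj e) = perpProj (g e) := by
  ext x
  rw [conj_apply, perpProj_apply, perpProj_apply, map_sub, map_smul, ← g.symm.inner_map_map (g e)]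
  simp

theorem continuous_lineProj : Continuous (lineProj : V → V →L[ℂ] V) := by
  exact (ContinuousLinearMap.smulRightL ℂ V V).continuous₂.comp
    ((innerSL ℂ).continuous.prodMk continuous_id)

theorem continuous_perpProj : Continuous (perpProj : V → V →L[ℂ] V) :=
  continuous_const.sub continuous_lineProj

theorem norm_perpProj_le {e : V} (he : ‖e‖ = 1) : ‖perpProj e‖ ≤ 1 := by
  refine ContinuousLinearMap.opNorm_le_bound _ zero_le_one fun x => ?_
  have h : inner ℂ (perpProj e x) (inner ℂ e x • e) = 0 := by
    simp [he]
  have h2 := norm_add_sq_eq_norm_sq_add_norm_sq_of_inner_eq_zero _ _ h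
  have h3 : perpProj e x + inner ℂ e x • e = x := by simp
  rw [h3] at h2
  nlinarith [norm_nonneg (perpProj e x), norm_nonneg x, mul_self_nonneg ‖inner ℂ e x • e‖]

/-- Unit vectors on one line differ by a phase, which cancels in `e e*`. Hence `lineProj e`, rather
than `e`, is what a point of `F_1` remembers. -/
theorem lineProj_eq_of_smul_eq {e e' : V} (he : ‖e‖ = 1) (he' : ‖e'‖ = 1) {a b : ℂ} (ha : a ≠ 0)
    (h : a • e = b • e') : lineProj e = lineProj e' := by
  have hab : ‖a‖ = ‖b‖ := by simpa [norm_smul, he, he'] using congrArg norm h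
  have hu : ‖b / a‖ = 1 := by
    rw [norm_div, hab, div_self (by rw [← hab]; exact norm_ne_zero_iff.2 ha)]
  have hee : e = (b / a) • e' := by
    rw [div_eq_inv_mul, mul_smul, ← h, inv_smul_smul₀ ha]
  ext x
  rw [lineProj_apply, lineProj_apply, hee, inner_smul_left, smul_smul, mul_right_comm,
    ← Complex.normSq_eq_conj_mul_self, Complex.normSq_eq_norm_sq, hu]
  simp

theorem perpProj_eq {e f : V} (hf : ∀ x, x = inner ℂ e x • e + inner ℂ f x • f) (x : V) :
    perpProj e x = inner ℂ f x • f := by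
  rw [perpProj_apply, sub_eq_iff_eq_add']
  exact hf x

/-- The complement of a line is again a line because `dim V = 2`; `f` is a unit vector on it. -/
theorem exists_perp [hV : Fact (finrank ℂ V = 2)] {e : V} (he : ‖e‖ = 1) :
    ∃ f : V, ‖f‖ = 1 ∧ inner ℂ e f = (0 : ℂ) ∧ ∀ x, x = inner ℂ e x • e + inner ℂ f x • f := by
  have : Fact (finrank ℂ V = 1 + 1) := ⟨hV.out⟩
  have he0 : e ≠ 0 := by rintro rfl; simp at he
  have h1 : finrank ℂ (Submodule.span ℂ {e})ᗮ = 1 := Submodule.finrank_orthogonal_span_singleton he0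
  have : Nontrivial (Submodule.span ℂ {e})ᗮ :=
    Module.nontrivial_of_finrank_pos (R := ℂ) (by rw [h1]; norm_num)
  obtain ⟨⟨f, hf⟩, hf1⟩ := exists_norm_eq (Submodule.span ℂ {e})ᗮ zero_le_one
  replace hf1 : ‖f‖ = 1 := hf1
  have hef : inner ℂ e f = (0 : ℂ) := Submodule.mem_orthogonal_singleton_iff_inner_right.1 hf
  refine ⟨f, hf1, hef, fun x => ?_⟩
  have hx : x - inner ℂ e x • e ∈ (Submodule.span ℂ {e})ᗮ := by
    rw [Submodule.mem_orthogonal_singleton_iff_inner_right]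
    simp [inner_sub_right, inner_smul_right, he]
  have hf0 : (⟨f, hf⟩ : (Submodule.span ℂ {e})ᗮ) ≠ 0 := by
    intro h
    have : f = 0 := congrArg Subtype.val h
    simp [this] at hf1
  obtain ⟨c, hc⟩ := (finrank_eq_one_iff_of_nonzero' _ hf0).1 h1 ⟨_, hx⟩
  replace hc : c • f = x - inner ℂ e x • e := congrArg Subtype.val hc
  have hfe : inner ℂ f e = (0 : ℂ) := inner_eq_zero_symm.1 hef
  have : inner ℂ f x = c := by
    have := congrArg (inner ℂ f) hc
    simpa [inner_smul_right, inner_sub_right, hfe, hf1] using this.symm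
  rw [this, hc]; simp

theorem norm_perpProj [hV : Fact (finrank ℂ V = 2)] {e : V} (he : ‖e‖ = 1) : ‖perpProj e‖ = 1 := by
  refine le_antisymm (norm_perpProj_le he) ?_
  obtain ⟨f, hf, hef, -⟩ := exists_perp he
  have h := (perpProj e).le_opNorm f
  simpa [hef, hf] using h

variable [FiniteDimensional ℂ V] [hV : Fact (finrank ℂ V = 2)]

/-! ### The lowest eigenvalue -/

/-- The lowest eigenvalue of a selfadjoint endomorphism. -/
def lowEig (α : SelfAdj V) : ℝ := eig α ⟨0, by rw [hV.out]; norm_num⟩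

/-- The difference of a selfadjoint endomorphism and its lowest eigenvalue. -/
def excess (α : SelfAdj V) : V →L[ℂ] V := α.1 - (lowEig α : ℂ) • 1

theorem excess_apply (α : SelfAdj V) (x : V) : excess α x = α.1 x - (lowEig α : ℂ) • x := rfl

theorem coe_eq_excess (α : SelfAdj V) : α.1 = (lowEig α : ℂ) • 1 + excess α := by
  simp [excess]

theorem excess_isSymmetric (α : SelfAdj V) : (excess α : V →ₗ[ℂ] V).IsSymmetric := fun x y => by
  have := α.2 x y
  simp only [ContinuousLinearMap.coe_coe] at this
  simp [-Complex.coe_smul, excess, inner_sub_left, inner_sub_right, inner_smul_left,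
    inner_smul_right, this]

theorem exists_excess_eq_zero (α : SelfAdj V) : ∃ x : V, ‖x‖ = 1 ∧ excess α x = 0 := by
  refine ⟨α.2.eigenvectorBasis rfl (Fin.rev ⟨0, by rw [hV.out]; norm_num⟩),
    OrthonormalBasis.norm_eq_one _ _, ?_⟩
  rw [excess_apply, sub_eq_zero]
  exact α.2.apply_eigenvectorBasis rfl _

theorem re_inner_excess_nonneg (α : SelfAdj V) (x : V) : 0 ≤ (inner ℂ (excess α x) x).re := by
  set b := α.2.eigenvectorBasis rfl
  have h (i) : inner ℂ (excess α x) (b i) =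
      ((α.2.eigenvalues rfl i - lowEig α : ℝ) : ℂ) * inner ℂ x (b i) := by
    have h1 := excess_isSymmetric α x (b i)
    simp only [ContinuousLinearMap.coe_coe] at h1
    have h2 : α.1 (b i) = (α.2.eigenvalues rfl i : ℂ) • b i := α.2.apply_eigenvectorBasis rfl i
    rw [h1, excess_apply, h2, ← sub_smul, inner_smul_right]
    simp
  rw [← b.sum_inner_mul_inner, Complex.re_sum]
  refine Finset.sum_nonneg fun i _ => ?_
  rw [h, mul_assoc, ← inner_conj_symm (b i) x, Complex.mul_conj, ← Complex.ofReal_mul,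
    Complex.ofReal_re]
  refine mul_nonneg (sub_nonneg.2 ?_) (Complex.normSq_nonneg _)
  -- The eigenvalues are listed in decreasing order, so the lowest one has the last index.
  refine α.2.eigenvalues_antitone rfl ?_
  rw [Fin.le_def, Fin.val_rev]
  have := i.2
  change (i : ℕ) ≤ finrank ℂ V - (0 + 1)
  omega

theorem lowEig_le (α : SelfAdj V) {x : V} (hx : ‖x‖ = 1) :
    lowEig α ≤ (inner ℂ (α.1 x) x).re := by
  have := re_inner_excess_nonneg α x
  rw [excess_apply, inner_sub_left, inner_smul_left, inner_self_of_norm_one hx] at this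
  simpa using this

theorem inner_of_excess_eq_zero (α : SelfAdj V) {x : V} (hx : ‖x‖ = 1) (h : excess α x = 0) :
    (inner ℂ (α.1 x) x).re = lowEig α := by
  rw [excess_apply, sub_eq_zero] at h
  rw [h, inner_smul_left, inner_self_of_norm_one hx]
  simp

theorem lowEig_eq (α : SelfAdj V) (c : ℝ)
    (h0 : ∀ x, ‖x‖ = 1 → c ≤ (inner ℂ (α.1 x) x).re)
    {e : V} (he : ‖e‖ = 1) (h1 : (inner ℂ (α.1 e) e).re = c) : lowEig α = c := by
  obtain ⟨x, hx, hx0⟩ := exists_excess_eq_zero α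
  exact le_antisymm (h1 ▸ lowEig_le α he) (inner_of_excess_eq_zero α hx hx0 ▸ h0 x hx)

/-- Rayleigh quotient: `α` is tested on a lowest eigenvector of `β`. By symmetry the lowest
eigenvalue is 1-Lipschitz. -/
theorem lowEig_le_add (α β : SelfAdj V) : lowEig α ≤ lowEig β + ‖α.1 - β.1‖ := by
  obtain ⟨x, hx, hx0⟩ := exists_excess_eq_zero β
  have h1 := lowEig_le α hx
  have h2 := inner_of_excess_eq_zero β hx hx0
  have h3 : (inner ℂ ((α.1 - β.1) x) x).re ≤ ‖α.1 - β.1‖ := by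
    refine (Complex.re_le_norm _).trans ((norm_inner_le_norm _ _).trans ?_)
    have := (α.1 - β.1).le_opNorm x
    simpa [hx] using this
  rw [sub_apply, inner_sub_left, Complex.sub_re] at h3
  linarith

theorem continuous_lowEig : Continuous (lowEig : SelfAdj V → ℝ) := by
  have : LipschitzWith 1 (lowEig : SelfAdj V → ℝ) := by
    refine LipschitzWith.of_le_add_mul 1 fun α β => ?_
    rw [NNReal.coe_one, one_mul, Subtype.dist_eq, dist_eq_norm]
    exact lowEig_le_add α β
  exact this.continuous

theorem continuous_excess : Continuous (excess : SelfAdj V → V →L[ℂ] V) :=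
  continuous_subtype_val.sub
    ((Complex.continuous_ofReal.comp continuous_lowEig).smul continuous_const)

theorem lowEig_smul (g : V ≃ₗᵢ[ℂ] V) (α : SelfAdj V) : lowEig (g • α) = lowEig α :=
  eig_smul g α _

theorem excess_smul (g : V ≃ₗᵢ[ℂ] V) (α : SelfAdj V) : excess (g • α) = conj g (excess α) := by
  ext x
  rw [excess_apply, lowEig_smul, SelfAdj.coe_smul, conj_apply, conj_apply, excess_apply, map_sub,
    map_smul, g.apply_symm_apply]

/-- By symmetry the line orthogonal to `e` is invariant, so `excess α` acts on it by a scalar. This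
scalar is real and nonnegative, hence equal to the norm. -/
theorem excess_eq_of_apply_eq_zero (α : SelfAdj V) {e : V} (he : ‖e‖ = 1) (h : excess α e = 0) :
    excess α = (‖excess α‖ : ℂ) • perpProj e := by
  obtain ⟨f, hf, hef, hx⟩ := exists_perp he
  have hsym (x y : V) : inner ℂ (excess α x) y = inner ℂ x (excess α y) :=
    excess_isSymmetric α x y
  have hc : excess α f = inner ℂ f (excess α f) • f := by
    conv_lhs => rw [hx (excess α f)]
    rw [← hsym, h]; simp
  obtain ⟨r, hr0, hr⟩ : ∃ r : ℝ, 0 ≤ r ∧ inner ℂ f (excess α f) = (r : ℂ) := by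
    refine ⟨(inner ℂ (excess α f) f).re, re_inner_excess_nonneg α f, ?_⟩
    rw [← hsym]
    exact ((excess_isSymmetric α).coe_re_inner_apply_self f).symm
  have key : excess α = (r : ℂ) • perpProj e := by
    ext x
    rw [smul_apply, perpProj_eq hx]
    conv_lhs => rw [hx x]
    rw [map_add, map_smul, map_smul, h, hc, hr, smul_zero, zero_add, smul_comm]
  have : ‖excess α‖ = r := by
    rw [key, norm_smul, norm_perpProj he, mul_one, Complex.norm_of_nonneg hr0]
  rw [this]
  exact key

theorem exists_excess_eq (α : SelfAdj V) :
    ∃ e : V, ‖e‖ = 1 ∧ excess α = (‖excess α‖ : ℂ) • perpProj e := by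
  obtain ⟨e, he, h⟩ := exists_excess_eq_zero α
  exact ⟨e, he, excess_eq_of_apply_eq_zero α he h⟩

theorem lowEig_of_coe_eq (α : SelfAdj V) {c t : ℝ} (ht : 0 ≤ t) {e : V} (he : ‖e‖ = 1)
    (h : α.1 = (c : ℂ) • 1 + (t : ℂ) • perpProj e) : lowEig α = c := by
  obtain ⟨f, hf, hef, hx⟩ := exists_perp he
  refine lowEig_eq α c (fun x hx1 => ?_) he ?_
  · rw [h]
    simp only [add_apply, smul_apply, perpProj_eq hx,
      one_apply_eq_self, inner_add_left, inner_smul_left, inner_self_of_norm_one hx1,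
      Complex.conj_ofReal, mul_one, Complex.add_re, Complex.ofReal_re, le_add_iff_nonneg_right]
    rw [← Complex.normSq_eq_conj_mul_self, ← Complex.ofReal_mul, Complex.ofReal_re]
    exact mul_nonneg ht (Complex.normSq_nonneg _)
  · rw [h]
    simp [-inner_self_eq_norm_sq_to_K, inner_self_of_norm_one he]

theorem excess_of_coe_eq (α : SelfAdj V) {c t : ℝ} (ht : 0 ≤ t) {e : V} (he : ‖e‖ = 1)
    (h : α.1 = (c : ℂ) • 1 + (t : ℂ) • perpProj e) : excess α = (t : ℂ) • perpProj e := by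
  rw [excess, lowEig_of_coe_eq α ht he h, h, add_sub_cancel_left]

theorem norm_coe_le (α : SelfAdj V) : ‖α.1‖ ≤ |lowEig α| + ‖excess α‖ := by
  conv_lhs => rw [coe_eq_excess α]
  refine (norm_add_le _ _).trans (add_le_add_left ?_ _)
  rw [norm_smul, Complex.norm_real, Real.norm_eq_abs]
  exact mul_le_of_le_one_right (abs_nonneg _) ContinuousLinearMap.norm_id_le

/-! ### The top space -/

theorem topSpace_one_eq (α : SelfAdj V) :
    topSpace 1 α = (LinearMap.ker (excess α : V →ₗ[ℂ] V))ᗮ := by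
  have h : (LinearMap.ker (excess α : V →ₗ[ℂ] V)) =
      ⨆ j : Fin (Module.finrank ℂ V), ⨆ _ : (j : ℕ) + 1 < Module.finrank ℂ V,
        Module.End.eigenspace (α.1 : V →ₗ[ℂ] V) (eig α j : ℂ) := by
    have h0 : LinearMap.ker (excess α : V →ₗ[ℂ] V) =
        Module.End.eigenspace (α.1 : V →ₗ[ℂ] V) (lowEig α : ℂ) := by
      ext x
      rw [Module.End.mem_eigenspace_iff, LinearMap.mem_ker, ContinuousLinearMap.coe_coe,
        excess_apply, sub_eq_zero]
      rfl
    rw [h0]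
    refine le_antisymm (le_iSup₂_of_le ⟨0, by rw [hV.out]; norm_num⟩
      (by have := hV.out; simp only; omega) le_rfl) (iSup₂_le fun j hj => ?_)
    -- In dimension 2 the condition `j + 1 < 2` leaves only `j = 0`.
    have : j = ⟨0, by rw [hV.out]; norm_num⟩ := by
      ext
      have := hV.out
      simp only
      omega
    rw [this]
    rfl
  rw [h, topSpace]

/-- A symmetric map has range orthogonal to its kernel. Thus `θ` on `P_1(α)` is determined by `θ ∘
excess α`, an endomorphism of the fixed space `V`. -/
theorem topSpace_eq_range (α : SelfAdj V) :
    topSpace 1 α = LinearMap.range (excess α : V →ₗ[ℂ] V) := by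
  rw [topSpace_one_eq, ← (excess_isSymmetric α).orthogonal_range,
    Submodule.orthogonal_orthogonal]

theorem excess_mem_topSpace (α : SelfAdj V) (x : V) : excess α x ∈ topSpace 1 α := by
  rw [topSpace_eq_range]
  exact ⟨x, rfl⟩

theorem mem_topSpace_iff (α : SelfAdj V) (v : V) : v ∈ topSpace 1 α ↔ ∃ x, excess α x = v := by
  rw [topSpace_eq_range]
  rfl

end

section

/-! ### Clipping a vector to a ball -/

section Clip

variable {E : Type*} [NormedAddCommGroup E] [NormedSpace ℂ E]

/-- The vector on the segment from `0` to `v` which is at distance `min t ‖v‖` from `0`. -/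
def clip (t : ℝ) (v : E) : E := ((min t ‖v‖ / ‖v‖ : ℝ) : ℂ) • v

theorem clip_of_norm_le {t : ℝ} {v : E} (h : ‖v‖ ≤ t) : clip t v = v := by
  rcases eq_or_ne v 0 with rfl | hv
  · simp [clip]
  · rw [clip, min_eq_right h, div_self (norm_ne_zero_iff.2 hv), Complex.ofReal_one, one_smul]

@[simp] theorem clip_zero (t : ℝ) : clip t (0 : E) = 0 := by simp [clip]

@[simp] theorem clip_zero_left (v : E) : clip 0 v = 0 := by simp [clip]

theorem norm_clip {t : ℝ} (ht : 0 ≤ t) (v : E) : ‖clip t v‖ = min t ‖v‖ := by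
  rcases eq_or_ne v 0 with rfl | hv
  · simp [ht]
  · rw [clip, norm_smul, Complex.norm_of_nonneg (by positivity),
      div_mul_cancel₀ _ (norm_ne_zero_iff.2 hv)]

theorem norm_sub_clip_le {t : ℝ} (ht : 0 ≤ t) (v : E) : ‖v - clip t v‖ ≤ ‖v‖ := by
  rcases eq_or_ne v 0 with rfl | hv
  · simp
  have hv' : 0 < ‖v‖ := norm_pos_iff.2 hv
  have h0 : 0 ≤ min t ‖v‖ / ‖v‖ := by positivity
  have h1 : min t ‖v‖ / ‖v‖ ≤ 1 := (div_le_one hv').2 (min_le_right _ _)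
  have : v - clip t v = ((1 - min t ‖v‖ / ‖v‖ : ℝ) : ℂ) • v := by
    rw [clip, Complex.ofReal_sub, sub_smul, Complex.ofReal_one, one_smul]
  rw [this, norm_smul, Complex.norm_of_nonneg (by linarith)]
  exact mul_le_of_le_one_left hv'.le (by linarith)

/-- At `v = 0` the bound `‖clip t v‖ ≤ ‖v‖` replaces the quotient formula; it needs `0 ≤ t`, since a
negative `t` would give a jump there. -/
theorem continuousOn_clip :
    ContinuousOn (fun p : ℝ × E => clip p.1 p.2) {p | 0 ≤ p.1} := by
  rintro ⟨t, v⟩ ht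
  rcases eq_or_ne v 0 with rfl | hv
  · rw [ContinuousWithinAt, clip_zero, tendsto_zero_iff_norm_tendsto_zero]
    have h0 : Tendsto (fun p : ℝ × E => ‖p.2‖) (𝓝[{p | 0 ≤ p.1}] (t, 0)) (𝓝 0) := by
      have : Continuous fun p : ℝ × E => ‖p.2‖ := by fun_prop
      simpa using (this.tendsto (t, (0 : E))).mono_left nhdsWithin_le_nhds
    refine squeeze_zero' (Eventually.of_forall fun _ => norm_nonneg _) ?_ h0
    filter_upwards [self_mem_nhdsWithin] with p hp
    rw [norm_clip hp]
    exact min_le_right _ _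
  · have hv' : ‖v‖ ≠ 0 := norm_ne_zero_iff.2 hv
    refine ContinuousAt.continuousWithinAt ?_
    unfold clip
    refine ContinuousAt.smul (Complex.continuous_ofReal.continuousAt.comp ?_) continuousAt_snd
    exact ContinuousAt.div (by fun_prop) (by fun_prop) hv'

theorem continuous_clip {T : Type*} [TopologicalSpace T] {t : T → ℝ} {v : T → E}
    (ht : Continuous t) (ht0 : ∀ x, 0 ≤ t x) (hv : Continuous v) :
    Continuous fun x => clip (t x) (v x) :=
  continuousOn_clip.comp_continuous (ht.prodMk hv) ht0

end Clip

variable {V : Type*} [NormedAddCommGroup V] [InnerProductSpace ℂ V]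

/-! ### Conjugation of endomorphisms by unitary maps -/

theorem norm_conj (g : V ≃ₗᵢ[ℂ] V) (a : V →L[ℂ] V) : ‖conj g a‖ = ‖a‖ := by
  have key (g : V ≃ₗᵢ[ℂ] V) (a : V →L[ℂ] V) : ‖conj g a‖ ≤ ‖a‖ :=
    ContinuousLinearMap.opNorm_le_bound _ (norm_nonneg _) fun x => by
      simpa using a.le_opNorm (g.symm x)
  refine le_antisymm (key g a) ?_
  have h : conj g⁻¹ (conj g a) = a := by rw [← conj_mul, inv_mul_cancel, conj_one]
  conv_lhs => rw [← h]
  exact key _ _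

theorem conj_add (g : V ≃ₗᵢ[ℂ] V) (a b : V →L[ℂ] V) : conj g (a + b) = conj g a + conj g b := by
  ext; simp

theorem conj_sub (g : V ≃ₗᵢ[ℂ] V) (a b : V →L[ℂ] V) : conj g (a - b) = conj g a - conj g b := by
  ext; simp

theorem conj_smul (g : V ≃ₗᵢ[ℂ] V) (c : ℂ) (a : V →L[ℂ] V) : conj g (c • a) = c • conj g a := by
  ext; simp

theorem conj_one_right (g : V ≃ₗᵢ[ℂ] V) : conj g 1 = 1 := by
  ext; simp

theorem conj_clip (g : V ≃ₗᵢ[ℂ] V) (t : ℝ) (a : V →L[ℂ] V) :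
    conj g (clip t a) = clip t (conj g a) := by
  rw [clip, clip, conj_smul, norm_conj]

/-! ### Unitary maps of rank one -/

/-- The unitary map which multiplies `e` by `z` and fixes the complement of `e`. -/
def reflMap (z : ℂ) (e : V) : V →L[ℂ] V := 1 - (1 - z) • lineProj e

theorem reflMap_apply (z : ℂ) (e x : V) : reflMap z e x = x - (1 - z) • inner ℂ e x • e := rfl

theorem norm_reflMap_apply {z : ℂ} (hz : ‖z‖ = 1) {e : V} (he : ‖e‖ = 1) (x : V) :
    ‖reflMap z e x‖ = ‖x‖ := by
  -- The norm does not depend on the phase `w`, and `w = 1` gives the identity map.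
  have h (w : ℂ) (hw : ‖w‖ = 1) : ‖reflMap w e x‖ * ‖reflMap w e x‖ =
      ‖perpProj e x‖ * ‖perpProj e x‖ + ‖lineProj e x‖ * ‖lineProj e x‖ := by
    have h0 : inner ℂ (perpProj e x) (w • lineProj e x) = 0 := by
      simp [he]
    have h1 := norm_add_sq_eq_norm_sq_add_norm_sq_of_inner_eq_zero _ _ h0
    rw [norm_smul, hw, one_mul] at h1
    rw [← h1]
    have : reflMap w e x = perpProj e x + w • lineProj e x := by
      rw [reflMap_apply, perpProj_apply, lineProj_apply, sub_smul, one_smul]; abel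
    rw [this]
  have h1 := (h z hz).trans (h 1 (by simp)).symm
  rw [mul_self_inj (norm_nonneg _) (norm_nonneg _)] at h1
  simpa [reflMap] using h1

/-- The element `1 - (1 - z) e e*` of `F_1`. -/
def refl (z : Circle) (e : Metric.sphere (0 : V) 1) : Filt V 1 :=
  ⟨⟨reflMap z e, norm_reflMap_apply z.norm_coe (by simp)⟩, by
    refine (Submodule.finrank_mono (t := Submodule.span ℂ {(e : V)}) ?_).trans
      ((finrank_span_le_card _).trans (by simp))
    rintro _ ⟨x, rfl⟩
    refine Submodule.mem_span_singleton.2 ⟨-((1 - (z : ℂ)) * inner ℂ (e : V) x), ?_⟩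
    simp [reflMap_apply, mul_smul]⟩

theorem coe_refl (z : Circle) (e : Metric.sphere (0 : V) 1) :
    (refl z e).1.1 = 1 - (1 - (z : ℂ)) • lineProj (e : V) := rfl

theorem continuous_refl :
    Continuous fun p : Circle × Metric.sphere (0 : V) 1 => refl p.1 p.2 := by
  refine Continuous.subtype_mk (Continuous.subtype_mk ?_ _) _
  have := (continuous_lineProj (V := V)).comp
    (continuous_subtype_val.comp (continuous_snd (X := Circle) (Y := Metric.sphere (0 : V) 1)))
  exact continuous_const.sub ((continuous_const.sub
    (continuous_subtype_val.comp continuous_fst)).smul this)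

theorem continuousAt_refl {A : Type*} [TopologicalSpace A] {a : A} {ζ : A → Circle}
    {e : A → Metric.sphere (0 : V) 1} (hζ : ContinuousAt ζ a) (he : ContinuousAt e a) :
    ContinuousAt (fun x => refl (ζ x) (e x)) a := by
  have h := (continuous_refl (V := V)).continuousAt (x := (ζ a, e a))
  have h' := Filter.Tendsto.comp h (hζ.prodMk he)
  exact h'

theorem reflMap_smul (g : V ≃ₗᵢ[ℂ] V) (z : ℂ) (e : V) :
    reflMap z (g e) = conj g (reflMap z e) := by
  rw [reflMap, reflMap, conj_sub, conj_one_right, conj_smul, conj_lineProj]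

/-- The difference `T - (refl z e) ∘ T = (1 - z) e e* T` is nonzero with range the line of `e`, so
it determines this line and then `z`. It serves for `T = 1` (points of `F_1`) and for `T = excess α`
(points of `X̃'_1`). -/
theorem refl_eq_refl_iff {z z' : Circle} {e e' : Metric.sphere (0 : V) 1} (T : V →L[ℂ] V)
    (hz : z ≠ 1) (hT : lineProj (e : V) ∘L T ≠ 0)
    (h : (refl z e).1.1 ∘L T = (refl z' e').1.1 ∘L T) :
    lineProj (e : V) = lineProj (e' : V) ∧ z = z' := by
  have hz' : 1 - (z : ℂ) ≠ 0 := by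
    rw [sub_ne_zero]; intro h; exact hz (Circle.ext (by simpa using h.symm))
  have hx (x : V) : (1 - (z : ℂ)) • inner ℂ (e : V) (T x) • (e : V) =
      (1 - (z' : ℂ)) • inner ℂ (e' : V) (T x) • (e' : V) := by
    have := DFunLike.congr_fun h x
    simpa [coe_refl, sub_right_inj] using this
  obtain ⟨x, hx0⟩ : ∃ x, lineProj (e : V) (T x) ≠ 0 := by
    by_contra! h0
    exact hT (ContinuousLinearMap.ext h0)
  have h0 : inner ℂ (e : V) (T x) ≠ 0 := by
    intro h; apply hx0; rw [lineProj_apply, h, zero_smul]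
  have h1 : lineProj (e : V) = lineProj (e' : V) := by
    refine lineProj_eq_of_smul_eq (norm_eq_of_mem_sphere e) (norm_eq_of_mem_sphere e')
      (a := (1 - (z : ℂ)) * inner ℂ (e : V) (T x)) (b := (1 - (z' : ℂ)) * inner ℂ (e' : V) (T x))
      (mul_ne_zero hz' h0) ?_
    rw [mul_smul, mul_smul, hx]
  refine ⟨h1, ?_⟩
  have h2 := hx x
  rw [← lineProj_apply, ← lineProj_apply, ← h1] at h2
  have h3 := smul_left_injective ℂ hx0 h2
  exact Circle.ext (by linear_combination -h3)

theorem Isom.inner_map (φ : Isom V) (x y : V) : inner ℂ (φ.1 x) (φ.1 y) = inner ℂ x y :=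
  LinearIsometry.inner_map_map ⟨(φ.1 : V →ₗ[ℂ] V), φ.2⟩ x y

/-- An isometry fixing `f` preserves the line orthogonal to `f` and acts on it by a unit scalar. -/
theorem exists_refl_eq [hV : Fact (finrank ℂ V = 2)] (φ : Isom V) {f : V} (hf : ‖f‖ = 1)
    (h : φ.1 f = f) :
    ∃ z e, (refl z e).1 = φ := by
  obtain ⟨e, he, hfe, hx⟩ := exists_perp hf
  have h1 : φ.1 e = inner ℂ e (φ.1 e) • e := by
    conv_lhs => rw [hx (φ.1 e)]
    have : inner ℂ f (φ.1 e) = (0 : ℂ) := by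
      conv_lhs => rw [← h]
      rw [φ.inner_map, hfe]
    rw [this, zero_smul, zero_add]
  have h2 : ‖inner ℂ e (φ.1 e)‖ = 1 := by
    have := congrArg norm h1
    rw [norm_smul, φ.2, he] at this
    linarith
  refine ⟨⟨inner ℂ e (φ.1 e), mem_sphere_zero_iff_norm.2 h2⟩,
    ⟨e, mem_sphere_zero_iff_norm.2 he⟩, Subtype.ext (ContinuousLinearMap.ext fun x => ?_)⟩
  change reflMap (inner ℂ e (φ.1 e)) e x = φ.1 x
  rw [reflMap_apply, sub_smul, one_smul]
  conv_rhs => rw [hx x, map_add, map_smul, map_smul, h, h1]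
  rw [smul_comm, ← sub_add]
  congr 1
  rw [sub_eq_iff_eq_add]
  exact hx x

/-! ### Compactness of spheres and isometries, local compactness of `s(V)` -/

section

variable [FiniteDimensional ℂ V]

instance : ProperSpace (V →L[ℂ] V) := FiniteDimensional.proper ℂ _

instance : CompactSpace (Metric.sphere (0 : V) 1) := by
  have : ProperSpace V := FiniteDimensional.proper ℂ V
  infer_instance

theorem isClosed_isSymmetric : IsClosed {α : V →L[ℂ] V | (α : V →ₗ[ℂ] V).IsSymmetric} := by
  have : {α : V →L[ℂ] V | (α : V →ₗ[ℂ] V).IsSymmetric} =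
      ⋂ x : V, ⋂ y : V, {α | inner ℂ (α x) y = inner ℂ x (α y)} := by
    ext; simp [LinearMap.IsSymmetric]
  rw [this]
  refine isClosed_iInter fun x => isClosed_iInter fun y => isClosed_eq ?_ ?_ <;> fun_prop

instance : LocallyCompactSpace (SelfAdj V) :=
  isClosed_isSymmetric.isClosedEmbedding_subtypeVal.locallyCompactSpace

instance : CompactSpace (Isom V) := by
  refine isCompact_iff_compactSpace.1 (Metric.isCompact_of_isClosed_isBounded ?_ ?_)
  · change IsClosed {φ : V →L[ℂ] V | ∀ x, ‖φ x‖ = ‖x‖}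
    rw [ofPred_forall]
    refine isClosed_iInter fun x => isClosed_eq ?_ ?_ <;> fun_prop
  · refine (Metric.isBounded_closedBall (x := 0) (r := 1)).subset fun φ hφ => ?_
    rw [mem_closedBall_zero_iff]
    exact φ.opNorm_le_bound zero_le_one fun x => by rw [hφ, one_mul]

theorem tendsto_norm_cocompact_selfAdj :
    Tendsto (fun α : SelfAdj V => ‖α.1‖) (cocompact (SelfAdj V)) atTop :=
  (tendsto_norm_cocompact_atTop (E := V →L[ℂ] V)).comp
    isClosed_isSymmetric.isClosedEmbedding_subtypeVal.tendsto_cocompact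

end

variable [FiniteDimensional ℂ V] [hV : Fact (finrank ℂ V = 2)]

/-- In dimension 2, `rank (φ - I) ≤ 1` forces a nonzero fixed vector. -/
theorem refl_surjective :
    Function.Surjective fun p : Circle × Metric.sphere (0 : V) 1 => refl p.1 p.2 := by
  intro φ
  have h1 := LinearMap.finrank_range_add_finrank_ker ((φ.1.1 - 1 : V →L[ℂ] V) : V →ₗ[ℂ] V)
  have h2 := φ.2
  rw [hV.out] at h1
  have : Nontrivial (LinearMap.ker ((φ.1.1 - 1 : V →L[ℂ] V) : V →ₗ[ℂ] V)) :=
    Module.nontrivial_of_finrank_pos (R := ℂ) (by omega)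
  obtain ⟨⟨f, hf⟩, hf1⟩ := exists_norm_eq
    (LinearMap.ker ((φ.1.1 - 1 : V →L[ℂ] V) : V →ₗ[ℂ] V)) zero_le_one
  obtain ⟨z, e, h⟩ := exists_refl_eq φ.1 (f := f) hf1 (sub_eq_zero.1 hf)
  exact ⟨(z, e), Subtype.ext h⟩

instance : CompactSpace (Filt V 1) :=
  refl_surjective.compactSpace continuous_refl

end

section

variable {V : Type*} [NormedAddCommGroup V] [InnerProductSpace ℂ V]
  [FiniteDimensional ℂ V]

/-! ### The topology of `X̃'_1` -/

theorem continuous_restrictTop : Continuous (restrictTop 1 : _ → XTilde V 1) :=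
  continuous_coinduced_rng

theorem continuous_resUnbased : Continuous (resUnbased 1 : _ → XTilde V 1) :=
  continuous_restrictTop.comp
    (continuous_fst.prodMk (continuous_subtype_val.comp continuous_snd))

variable [hV : Fact (finrank ℂ V = 2)]

/-- The endomorphism `θ ∘ (α - e_0(α))` attached to a point `(α, θ)` of `X̃'_1`. -/
def XTilde.endo (x : XTilde V 1) : V →L[ℂ] V :=
  x.iso.toContinuousLinearMap ∘L (excess x.base).codRestrict _ (excess_mem_topSpace x.base)

theorem XTilde.endo_apply (x : XTilde V 1) (v : V) :
    x.endo v = x.iso ⟨excess x.base v, excess_mem_topSpace x.base v⟩ := rfl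

theorem endo_resUnbased (p : SelfAdj V × Filt V 1) :
    (resUnbased 1 p).endo = p.2.1.1 ∘L excess p.1 := rfl

theorem XTilde.eq_of_endo_eq {x y : XTilde V 1} (h : x.base = y.base) (h' : x.endo = y.endo) :
    x = y := by
  refine XTilde.ext' h fun v hx hy => ?_
  obtain ⟨α, θ⟩ := x
  obtain ⟨β, η⟩ := y
  obtain rfl : α = β := h
  obtain ⟨w, rfl⟩ := (mem_topSpace_iff α v).1 hx
  exact DFunLike.congr_fun h' w

/-- The pair `(α, θ ∘ (α - e_0(α)))` attached to a point `(α, θ)` of `X̃'_1`. -/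
def XTilde.toPair (x : XTilde V 1) : SelfAdj V × (V →L[ℂ] V) := (x.base, x.endo)

theorem XTilde.toPair_injective : Function.Injective (XTilde.toPair : XTilde V 1 → _) :=
  fun _ _ h => XTilde.eq_of_endo_eq (congrArg Prod.fst h) (congrArg Prod.snd h)

theorem continuous_toPair : Continuous (XTilde.toPair : XTilde V 1 → _) := by
  refine continuous_coinduced_dom.2 (continuous_fst.prodMk ?_)
  exact (continuous_subtype_val.comp continuous_snd).clm_comp
    (continuous_excess.comp continuous_fst)

/-- If `P_1(α)` is the line of `f` and `θ f = w`, a complex reflection along `w - f` carries `f` to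
`w`, and it lies in `F_1`. -/
theorem resUnbased_surjective : Function.Surjective (resUnbased 1 : _ → XTilde V 1) := by
  rintro ⟨α, θ⟩
  obtain ⟨e, he, h⟩ := exists_excess_eq α
  obtain ⟨f, hf, hef, hx⟩ := exists_perp he
  suffices ∃ φ : Filt V 1, φ.1.1 ∘L excess α = XTilde.endo ⟨α, θ⟩ by
    obtain ⟨φ, hφ⟩ := this
    exact ⟨(α, φ), XTilde.eq_of_endo_eq rfl hφ⟩
  rcases eq_or_ne ‖excess α‖ 0 with h0 | h0
  -- For scalar `α` the space `P_1(α)` is zero and any `φ` will do.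
  · refine ⟨refl 1 ⟨e, mem_sphere_zero_iff_norm.2 he⟩, ?_⟩
    have h1 : excess α = 0 := norm_eq_zero.1 h0
    ext v
    have h2 : (⟨excess α v, excess_mem_topSpace α v⟩ : topSpace 1 α) = 0 :=
      Subtype.ext (by simp [h1])
    rw [XTilde.endo_apply, h2, map_zero, h1]
    simp
  have hfm : f ∈ topSpace 1 α := by
    rw [mem_topSpace_iff]
    refine ⟨(‖excess α‖ : ℂ)⁻¹ • f, ?_⟩
    rw [h, map_smul, smul_apply, ← h, smul_smul,
      inv_mul_cancel₀ (by exact_mod_cast h0), one_smul, perpProj_apply, hef]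
    simp
  set w := θ ⟨f, hfm⟩
  have hw : ‖w‖ = 1 := by rw [θ.norm_map]; exact hf
  suffices ∃ φ : Filt V 1, φ.1.1 f = w by
    obtain ⟨φ, hφ⟩ := this
    refine ⟨φ, ?_⟩
    ext v
    have h1 : (excess α) v = ((‖excess α‖ : ℂ) * inner ℂ f v) • f := by
      rw [mul_smul, ← perpProj_eq hx, ← smul_apply, ← h]
    have h2 : (⟨excess α v, excess_mem_topSpace α v⟩ : topSpace 1 α) =
        ((‖excess α‖ : ℂ) * inner ℂ f v) • ⟨f, hfm⟩ := Subtype.ext h1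
    rw [XTilde.endo_apply, h2, map_smul]
    rw [ContinuousLinearMap.comp_apply, h1, map_smul, hφ]
  by_cases hwf : w = f
  · refine ⟨refl 1 ⟨e, mem_sphere_zero_iff_norm.2 he⟩, ?_⟩
    rw [hwf, coe_refl]
    simp
  have hn : ‖w - f‖ ≠ 0 := norm_ne_zero_iff.2 (sub_ne_zero.2 hwf)
  set c : ℂ := inner ℂ f w
  have hinner : inner ℂ (w - f) f = star c - 1 := by
    rw [inner_sub_left, inner_self_of_norm_one hf]
    congr 1
    exact (inner_conj_symm w f).symm
  have hsq : ((‖w - f‖ : ℂ)) ^ 2 = (1 - c) + (1 - star c) := by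
    have h1 : ((‖w - f‖ : ℂ)) ^ 2 = inner ℂ (w - f) (w - f) :=
      (inner_self_eq_norm_sq_to_K (𝕜 := ℂ) (w - f)).symm
    have h2 : inner ℂ w f = star c := (inner_conj_symm w f).symm
    rw [h1, inner_sub_left, inner_sub_right, inner_sub_right, inner_self_of_norm_one hf,
      inner_self_of_norm_one hw, h2]
    change 1 - star c - (c - 1) = _
    ring
  have hc : 1 - star c ≠ 0 := by
    intro h1
    have h2 : star c = 1 := (sub_eq_zero.1 h1).symm
    have h3 : c = 1 := by simpa using congrArg star h2
    rw [h3] at hsq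
    apply hn
    simpa using hsq
  -- With `e = (w - f)/‖w - f‖`, the equation `f - (1 - z)⟨e, f⟩ e = w` forces this value of `z`; it
  -- has modulus 1 because its numerator and denominator are conjugate up to sign.
  have hz : ‖-(1 - c) / (1 - star c)‖ = 1 := by
    have : ‖1 - star c‖ = ‖1 - c‖ := by
      rw [← norm_star (1 - c), star_sub, star_one]
    rw [norm_div, norm_neg, ← this, div_self (norm_ne_zero_iff.2 hc)]
  have he' : ‖(‖w - f‖ : ℂ)⁻¹ • (w - f)‖ = 1 := by
    rw [norm_smul, norm_inv, Complex.norm_real, norm_norm, inv_mul_cancel₀ hn]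
  refine ⟨refl ⟨_, mem_sphere_zero_iff_norm.2 hz⟩ ⟨_, mem_sphere_zero_iff_norm.2 he'⟩, ?_⟩
  change reflMap _ _ f = w
  have hn' : (‖w - f‖ : ℂ) ≠ 0 := by exact_mod_cast hn
  have key : (1 - -(1 - c) / (1 - star c)) * ((‖w - f‖ : ℂ)⁻¹ * (star c - 1) * (‖w - f‖ : ℂ)⁻¹)
      = -1 := by
    have : (‖w - f‖ : ℂ)⁻¹ * (star c - 1) * (‖w - f‖ : ℂ)⁻¹ =
        (star c - 1) / ((1 - c) + (1 - star c)) := by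
      rw [← hsq]; field_simp
    have h3 : (1 - c) + (1 - star c) ≠ 0 := by rw [← hsq]; exact pow_ne_zero _ hn'
    rw [this]
    field_simp
    ring
  rw [reflMap_apply, inner_smul_left, hinner, smul_smul, smul_smul, map_inv₀, Complex.conj_ofReal]
  rw [← mul_assoc] at key
  change f - ((1 - -(1 - c) / (1 - star c)) * _ * _) • (w - f) = w
  rw [key]
  simp

theorem restrictTop_surjective : Function.Surjective (restrictTop 1 : _ → XTilde V 1) := fun x =>
  let ⟨p, hp⟩ := resUnbased_surjective x
  ⟨(p.1, p.2.1), hp⟩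

/-- Pulled back to `s(V) × 𝓛(V, V)` and projected to `s(V)`, the map is proper since `𝓛(V, V)` is
compact. So the quotient topology on `X̃'_1` is that of a closed subspace of `s(V) × End V`. -/
theorem isProperMap_toPair : IsProperMap (XTilde.toPair : XTilde V 1 → _) := by
  refine isProperMap_of_comp_of_surj continuous_restrictTop continuous_toPair ?_
    restrictTop_surjective
  refine isProperMap_of_comp_of_t2 (continuous_toPair.comp continuous_restrictTop)
    continuous_fst ?_
  exact isProperMap_fst_of_compactSpace

theorem isClosedEmbedding_toPair : IsClosedEmbedding (XTilde.toPair : XTilde V 1 → _) :=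
  .of_continuous_injective_isClosedMap continuous_toPair XTilde.toPair_injective
    isProperMap_toPair.isClosedMap

instance : T2Space (XTilde V 1) := isClosedEmbedding_toPair.isEmbedding.t2Space

instance : LocallyCompactSpace (XTilde V 1) := isClosedEmbedding_toPair.locallyCompactSpace

theorem isProperMap_resUnbased : IsProperMap (resUnbased 1 : _ → XTilde V 1) := by
  refine isProperMap_of_comp_of_t2 continuous_resUnbased
    (continuous_fst.comp continuous_toPair) ?_
  exact isProperMap_fst_of_compactSpace

/-! ### The complements of `A` and `B` -/

theorem finrank_topSpace_of_ne_zero (α : SelfAdj V) (h : excess α ≠ 0) :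
    finrank ℂ (topSpace 1 α) = 1 := by
  have : Fact (finrank ℂ V = 1 + 1) := ⟨hV.out⟩
  obtain ⟨e, he, h1⟩ := exists_excess_eq α
  have h2 : LinearMap.ker (excess α : V →ₗ[ℂ] V) = Submodule.span ℂ {e} := by
    ext x
    have h3 : (‖excess α‖ : ℂ) ≠ 0 := by exact_mod_cast norm_ne_zero_iff.2 h
    rw [LinearMap.mem_ker, ContinuousLinearMap.coe_coe, h1, smul_apply, smul_eq_zero_iff_right h3,
      perpProj_apply, sub_eq_zero, Submodule.mem_span_singleton]
    refine ⟨fun h => ⟨_, h.symm⟩, ?_⟩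
    rintro ⟨a, rfl⟩
    rw [inner_smul_right, inner_self_of_norm_one he, mul_one]
  rw [topSpace_one_eq, h2]
  exact Submodule.finrank_orthogonal_span_singleton (by rintro rfl; simp at he)

/-- Off `B` the map `θ` is the inclusion. On a line, if `θ_1 - I` is not invertible then `θ w`
projects to `w`; having the same norm, it equals `w`. For scalar `α` both sides hold trivially. -/
theorem notMem_setB_iff (x : XTilde V 1) : x ∉ setB V 1 ↔ x.endo = excess x.base := by
  obtain ⟨α, θ⟩ := x
  change ¬(finrank ℂ (topSpace 1 α) = 1 ∧ IsUnit (firstBlock θ - 1)) ↔ _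
  by_cases h0 : excess α = 0
  · refine iff_of_true (fun h => ?_) ?_
    · have h1 : topSpace 1 α = ⊥ := by
        rw [topSpace_eq_range, h0]; simp
      have h2 := h.1
      rw [h1] at h2
      simp at h2
    · ext v
      have h2 : (⟨excess α v, excess_mem_topSpace α v⟩ : topSpace 1 α) = 0 :=
        Subtype.ext (by simp [h0])
      rw [XTilde.endo_apply]
      change θ ⟨excess α v, _⟩ = excess α v
      rw [h2, map_zero, h0]
      simp
  have h1 := finrank_topSpace_of_ne_zero α h0
  have hfix : XTilde.endo ⟨α, θ⟩ = excess α ↔ ∀ w, θ w = w := by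
    refine ⟨fun h w => ?_, fun h => ?_⟩
    · obtain ⟨w, hw⟩ := w
      obtain ⟨v, rfl⟩ := (mem_topSpace_iff α w).1 hw
      exact DFunLike.congr_fun h v
    · ext v
      exact h _
  have hblock (w : topSpace 1 α) :
      firstBlock θ w = (topSpace 1 α).orthogonalProjectionOnto (θ w) := rfl
  simp only [h1, true_and]
  rw [hfix, LinearMap.isUnit_iff_ker_eq_bot, ← ne_eq, Submodule.ne_bot_iff]
  have : Nontrivial (topSpace 1 α) :=
    Module.nontrivial_of_finrank_pos (R := ℂ) (by rw [h1]; norm_num)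
  constructor
  · rintro ⟨w, hw, hw0⟩ w'
    obtain ⟨c, rfl⟩ := (finrank_eq_one_iff_of_nonzero' w hw0).1 h1 w'
    rw [LinearMap.mem_ker, LinearMap.sub_apply, Module.End.one_apply, sub_eq_zero, hblock] at hw
    have h2 : θ w = w := by
      have h3 := (topSpace 1 α).starProjection_inner_eq_zero (θ w) w w.2
      rw [Submodule.starProjection_apply, hw] at h3
      -- Pythagoras: the component of `θ w` orthogonal to `P_1(α)` has norm zero.
      have h4 := norm_add_sq_eq_norm_sq_add_norm_sq_of_inner_eq_zero _ _ h3
      rw [sub_add_cancel, θ.norm_map] at h4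
      change ‖w‖ * ‖w‖ = _ + ‖w‖ * ‖w‖ at h4
      rw [right_eq_add, mul_self_eq_zero, norm_eq_zero, sub_eq_zero] at h4
      exact h4
    rw [map_smul, h2]
    rfl
  · intro h
    obtain ⟨w, hw⟩ := exists_ne (0 : topSpace 1 α)
    refine ⟨w, ?_, hw⟩
    rw [LinearMap.mem_ker, LinearMap.sub_apply, Module.End.one_apply, sub_eq_zero, hblock, h]
    simp

theorem mem_complB_iff (x : XTilde V 1) : x ∈ complB V 1 ↔ x.endo = excess x.base :=
  notMem_setB_iff x

theorem mem_complA_iff (p : SelfAdj V × Filt V 1) :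
    p ∈ complA V 1 ↔ p.2.1.1 ∘L excess p.1 = excess p.1 := by
  exact mem_complB_iff (resUnbased 1 p)

theorem isClosed_complB : IsClosed (complB V 1 : Set (XTilde V 1)) := by
  have : (complB V 1 : Set (XTilde V 1)) = {x | x.toPair.2 = excess x.toPair.1} := by
    ext x; exact mem_complB_iff x
  rw [this]
  exact isClosed_eq (continuous_snd.comp continuous_toPair)
    (continuous_excess.comp (continuous_fst.comp continuous_toPair))

theorem isClosed_complA : IsClosed (complA V 1 : Set (SelfAdj V × Filt V 1)) :=
  isClosed_complB.preimage continuous_resUnbased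

end

section

/-! ### Homotopy equivalences from homotopies on a covering space -/

section Descent

variable {V : Type*} [NormedAddCommGroup V] [InnerProductSpace ℂ V]
  {G : Type*} [Group G] (ρ : G →* (V ≃ₗᵢ[ℂ] V))
  {T X Z : Type*} [TopologicalSpace T] [TopologicalSpace X] [TopologicalSpace Z]
  [MulAction (V ≃ₗᵢ[ℂ] V) X] [MulAction (V ≃ₗᵢ[ℂ] V) Z]
  [CompactSpace T] [T2Space (OnePoint X)] [T2Space (OnePoint Z)]

/-- A continuous surjection from a compact to a Hausdorff space is closed, and this survives the
factor `I`; so homotopies descend. -/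
theorem isQuotientMap_prodMap {A B : Type*} [TopologicalSpace A] [TopologicalSpace B]
    [CompactSpace A] [T2Space B] {p : A → B} (hp : Continuous p) (hs : Function.Surjective p) :
    IsQuotientMap (Prod.map id p : I × A → I × B) := by
  have hc : Continuous (Prod.map id p : I × A → I × B) := continuous_id.prodMap hp
  exact hc.isClosedMap.isQuotientMap hc (Function.surjective_id.prodMap hs)

theorem exists_lift_of_isQuotientMap {A B C : Type*} [TopologicalSpace A] [TopologicalSpace B]
    [TopologicalSpace C] {q : A → B} (hq : IsQuotientMap q) {g : A → C} (hg : Continuous g)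
    (h : ∀ a b, q a = q b → g a = g b) : ∃ φ : C(B, C), ∀ a, φ (q a) = g a :=
  ⟨hq.lift (f := ⟨q, hq.continuous⟩) ⟨g, hg⟩ (fun _ _ e => h _ _ e), fun a =>
    DFunLike.congr_fun (hq.lift_comp (f := ⟨q, hq.continuous⟩) ⟨g, hg⟩ fun _ _ e => h _ _ e) a⟩

theorem exists_lift_of_isEmbedding {A B C : Type*} [TopologicalSpace A] [TopologicalSpace B]
    [TopologicalSpace C] {i : A → B} (hi : IsEmbedding i) {F : C → B} (hF : Continuous F)
    (h : ∀ c, F c ∈ range i) : ∃ F' : C → A, Continuous F' ∧ ∀ c, i (F' c) = F c := by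
  choose F' hF' using h
  refine ⟨F', hi.continuous_iff.2 ?_, hF'⟩
  rwa [show i ∘ F' = F from funext hF']

/-- Two homotopies `H`, `K` of a surjection `p : T → X_∞`, defined on a compact space `T`, show that
`f : X_∞ → Z_∞` is a based `G`-homotopy equivalence, if `H` descends to `X_∞`, the end of `H` and
the composite of `f` with `K` descend to `Z_∞`, and the composites of `f` with the ends of `H` and
`K` agree. -/
theorem isBasedGHomotopyEquiv_of_homotopies (f : OnePoint X → OnePoint Z) (p : T → OnePoint X)
    (H K : I × T → OnePoint X)
    (hf : Continuous f) (hfs : Function.Surjective f)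
    (hf0 : f ∞ = ∞) (hfG : ∀ (g : G) x, f (ρ g • x) = ρ g • f x)
    (hp : Continuous p) (hps : Function.Surjective p)
    (hH : Continuous H) (hK : Continuous K)
    (hH0 : ∀ t, H (0, t) = p t) (hK0 : ∀ t, K (0, t) = p t)
    (hHp : ∀ s t t', p t = p t' → H (s, t) = H (s, t'))
    (hH1 : ∀ t t', f (p t) = f (p t') → H (1, t) = H (1, t'))
    (hKf : ∀ s t t', f (p t) = f (p t') → f (K (s, t)) = f (K (s, t')))
    (hHK : ∀ t, f (H (1, t)) = f (K (1, t)))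
    (hbase : ∃ t₀, p t₀ = ∞ ∧ ∀ s, H (s, t₀) = ∞ ∧ K (s, t₀) = ∞)
    (hequi : ∀ (g : G) t, ∃ t', p t' = ρ g • p t ∧
      ∀ s, H (s, t') = ρ g • H (s, t) ∧ K (s, t') = ρ g • K (s, t)) :
    IsBasedGHomotopyEquiv ρ f := by
  obtain ⟨t₀, ht₀, hb⟩ := hbase
  have hfp : Continuous (f ∘ p) := hf.comp hp
  have hfps : Function.Surjective (f ∘ p) := hfs.comp hps
  have q₀ : IsQuotientMap (f ∘ p) := hfp.isClosedMap.isQuotientMap hfp hfps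
  have q₁ := isQuotientMap_prodMap hp hps
  have q₂ := isQuotientMap_prodMap hfp hfps
  obtain ⟨h, hh⟩ := exists_lift_of_isQuotientMap q₁ hH (by
    rintro ⟨s, t⟩ ⟨s', t'⟩ e
    obtain rfl : s = s' := congrArg Prod.fst e
    exact hHp _ _ _ (congrArg Prod.snd e))
  replace hh (s t) : h (s, p t) = H (s, t) := hh (s, t)
  obtain ⟨k, hk⟩ := exists_lift_of_isQuotientMap q₂ (hf.comp hK) (by
    rintro ⟨s, t⟩ ⟨s', t'⟩ e
    obtain rfl : s = s' := congrArg Prod.fst e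
    exact hKf _ _ _ (congrArg Prod.snd e))
  replace hk (s t) : k (s, f (p t)) = f (K (s, t)) := hk (s, t)
  -- The homotopy inverse of `f` is the end of `H`, descended along `f ∘ p`.
  obtain ⟨γ, hγ⟩ := exists_lift_of_isQuotientMap q₀ (g := fun t => H (1, t))
    (hH.comp (by fun_prop)) hH1
  replace hγ (t) : γ (f (p t)) = H (1, t) := hγ t
  refine ⟨⟨f, hf⟩, γ, rfl, ⟨hf0, hfG⟩, ⟨?_, fun g z => ?_⟩, ?_, ?_⟩
  · rw [← hf0, ← ht₀, hγ, (hb 1).1, ht₀]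
  · obtain ⟨t, rfl⟩ := hfps z
    obtain ⟨t', h1, h2⟩ := hequi g t
    rw [Function.comp_apply, ← hfG, ← h1, hγ, hγ, (h2 1).1]
  -- The homotopy `h` runs from the identity to `γ ∘ f`.
  · refine ContinuousMap.HomotopicWith.symm ⟨⟨⟨h, fun x => ?_, fun x => ?_⟩,
      fun s => ⟨?_, fun g x => ?_⟩⟩⟩
    · obtain ⟨t, rfl⟩ := hps x
      exact (hh 0 t).trans (hH0 t)
    · obtain ⟨t, rfl⟩ := hps x
      exact (hh 1 t).trans (hγ t).symm
    · change h (s, ∞) = ∞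
      rw [← ht₀, hh, (hb s).1, ht₀]
    · change h (s, ρ g • x) = ρ g • h (s, x)
      obtain ⟨t, rfl⟩ := hps x
      obtain ⟨t', h1, h2⟩ := hequi g t
      rw [← h1, hh, hh, (h2 s).1]
  -- The homotopy `k` runs from the identity to `f ∘ γ`, because `f ∘ K` and `f ∘ H` have the same
  -- end.
  · refine ContinuousMap.HomotopicWith.symm ⟨⟨⟨k, fun x => ?_, fun x => ?_⟩,
      fun s => ⟨?_, fun g x => ?_⟩⟩⟩
    · obtain ⟨t, rfl⟩ := hfps x
      exact (hk 0 t).trans (congrArg f (hK0 t))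
    · obtain ⟨t, rfl⟩ := hfps x
      exact (hk 1 t).trans ((hHK t).symm.trans (congrArg f (hγ t).symm))
    · change k (s, ∞) = ∞
      rw [← hf0, ← ht₀, hk, (hb s).2, ht₀]
    · change k (s, ρ g • x) = ρ g • k (s, x)
      obtain ⟨t, rfl⟩ := hfps x
      obtain ⟨t', h1, h2⟩ := hequi g t
      rw [Function.comp_apply, ← hfG, ← h1, hk, hk, (h2 s).2, hfG]

end Descent

/-! ### Maps of one-point compactifications -/

section OnePoint

theorem onePointMap_surjective {X Y : Type*} {f : X → Y} (hf : Function.Surjective f) :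
    Function.Surjective (OnePoint.map f) := fun y => by
  induction y using OnePoint.rec with
  | infty => exact ⟨∞, rfl⟩
  | coe y =>
    obtain ⟨x, rfl⟩ := hf y
    exact ⟨(x : OnePoint X), rfl⟩

theorem mem_range_onePointMap_val {X : Type*} {S : Set X} {x : OnePoint X} :
    x ∈ range (OnePoint.map (Subtype.val : S → X)) ↔ ∀ y : X, x = y → y ∈ S := by
  constructor
  · rintro ⟨a, rfl⟩ y hy
    induction a using OnePoint.rec with
    | infty => exact absurd hy (OnePoint.infty_ne_coe y)
    | coe a => rw [OnePoint.map_some, OnePoint.coe_eq_coe] at hy; exact hy ▸ a.2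
  · intro h
    induction x using OnePoint.rec with
    | infty => exact ⟨∞, rfl⟩
    | coe x => exact ⟨((⟨x, h x rfl⟩ : S) : OnePoint S), rfl⟩

variable {X Y : Type*} [TopologicalSpace X] [TopologicalSpace Y]

theorem continuous_onePointMap [T2Space X] [T2Space Y] [WeaklyLocallyCompactSpace Y] {f : X → Y}
    (hf : IsProperMap f) : Continuous (OnePoint.map f) := by
  refine OnePoint.continuous_map hf.continuous ?_
  rw [coclosedCompact_eq_cocompact, coclosedCompact_eq_cocompact]
  exact (isProperMap_iff_tendsto_cocompact.1 hf).2

theorem isClosedEmbedding_onePointMap_val [T2Space X] [LocallyCompactSpace X] {S : Set X}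
    (hS : IsClosed S) : IsClosedEmbedding (OnePoint.map (Subtype.val : S → X)) :=
  (continuous_onePointMap hS.isClosedEmbedding_subtypeVal.isProperMap).isClosedEmbedding
    (Option.map_injective Subtype.val_injective)

/-- A map into `X_∞` tends to `∞` if some continuous function on `X` tends to infinity along it. -/
theorem tendsto_infty_of_one_le_mul {N : X → ℝ} (hN : Continuous N) {A : Type*} {l : Filter A}
    {F : A → OnePoint X} {w : A → ℝ} (h : ∀ a (x : X), F a = x → 1 ≤ w a * N x)
    (hw : Tendsto w l (𝓝 0)) : Tendsto F l (𝓝 ∞) := by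
  refine OnePoint.hasBasis_nhds_infty.tendsto_right_iff.2 fun s hs => ?_
  -- `N` is bounded on the compact set `s`, so `1 ≤ w * N` fails there once `w` is small.
  obtain ⟨C, hC⟩ := hs.2.exists_bound_of_continuousOn hN.continuousOn
  have h1 : Tendsto (fun a => |w a| * |C|) l (𝓝 0) := by simpa using hw.abs.mul_const |C|
  filter_upwards [h1.eventually_lt_const one_pos] with a ha
  by_contra hF
  simp only [mem_union, mem_image, mem_compl_iff, mem_singleton_iff, not_or, not_exists,
    not_and] at hF
  obtain ⟨x, hx⟩ := OnePoint.ne_infty_iff_exists.1 hF.2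
  have hxs : x ∈ s := by
    by_contra hxs
    exact hF.1 x hxs hx
  have h2 := h a x hx.symm
  have h3 : w a * N x ≤ |w a| * |C| := by
    refine (le_abs_self _).trans ?_
    rw [abs_mul]
    exact mul_le_mul_of_nonneg_left ((hC x hxs).trans (le_abs_self C)) (abs_nonneg _)
  linarith

end OnePoint

end

section

/-! ### Polar angles, and the triples covering `s(V) × F_1` -/

/-- The direction of a nonzero complex number. -/
def direction (q : ℂ) : Circle :=
  -- The value at `0` is immaterial: radius zero is sent to `∞` whatever the angle.
  if h : q = 0 then 1 else
    ⟨q / (‖q‖ : ℂ), show _ ∈ Submonoid.unitSphere ℂ from mem_sphere_zero_iff_norm.2 (by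
      rw [norm_div, Complex.norm_real, norm_norm, div_self (norm_ne_zero_iff.2 h)])⟩

theorem coe_direction {q : ℂ} (h : q ≠ 0) : (direction q : ℂ) = q / (‖q‖ : ℂ) := by
  have : direction q = _ := dif_neg h
  rw [this]

theorem direction_coe (z : Circle) : direction z = z :=
  Circle.ext (by rw [coe_direction z.coe_ne_zero, z.norm_coe]; simp)

theorem direction_one : direction 1 = 1 := by
  simpa using direction_coe 1

theorem continuousAt_direction {q : ℂ} (h : q ≠ 0) : ContinuousAt direction q := by
  have h0 : IsInducing ((↑) : Circle → ℂ) := IsInducing.subtypeVal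
  refine h0.continuousAt_iff.2 ?_
  have h1 : ContinuousAt (fun q : ℂ => q / (‖q‖ : ℂ)) q := by
    refine continuousAt_id.div ?_ (by simpa using h)
    exact (Complex.continuous_ofReal.comp continuous_norm).continuousAt
  refine h1.congr ?_
  filter_upwards [isOpen_ne.mem_nhds h] with q hq
  exact (coe_direction hq).symm

theorem norm_one_sub_coe_le (z : Circle) : ‖1 - (z : ℂ)‖ ≤ 2 := by
  refine (norm_sub_le _ _).trans ?_
  rw [z.norm_coe, norm_one]
  norm_num

/-- The point is a convex combination of `1` and `z`, and the unit disc is convex. -/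
theorem norm_one_sub_clip_le {t : ℝ} (ht : 0 ≤ t) (z : Circle) :
    ‖1 - clip t (1 - (z : ℂ))‖ ≤ 1 := by
  rcases eq_or_ne (1 - (z : ℂ)) 0 with h | h
  · rw [h]; simp
  have h' : 0 < ‖1 - (z : ℂ)‖ := norm_pos_iff.2 h
  rw [clip]
  set u := min t ‖1 - (z : ℂ)‖ / ‖1 - (z : ℂ)‖
  have h0 : 0 ≤ u := by positivity
  have h1 : u ≤ 1 := (div_le_one h').2 (min_le_right _ _)
  have : 1 - (u : ℂ) • (1 - (z : ℂ)) = ((1 - u : ℝ) : ℂ) + (u : ℂ) * z := by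
    rw [smul_eq_mul]; push_cast; ring
  rw [this]
  refine (norm_add_le _ _).trans ?_
  rw [norm_mul, z.norm_coe, Complex.norm_of_nonneg h0, Complex.norm_of_nonneg (by linarith)]
  linarith

variable {V : Type*} [NormedAddCommGroup V] [InnerProductSpace ℂ V]

variable (V) in
/-- The space of triples `(α, z, e)`, which maps onto `s(V) × F_1` by
`(α, z, e) ↦ (α, 1 - (1 - z) e e*)`. -/
abbrev Cover : Type _ := SelfAdj V × Circle × Metric.sphere (0 : V) 1

/-- The surjection from the space of triples `(α, z, e)` to `s(V) × F_1`. -/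
def Cover.proj (y : Cover V) : SelfAdj V × Filt V 1 := (y.1, refl y.2.1 y.2.2)

/-- Conjugation on the space of triples `(α, z, e)`. -/
def Cover.act (g : V ≃ₗᵢ[ℂ] V) (y : Cover V) : Cover V :=
  (g • y.1, y.2.1, ⟨g y.2.2, mem_sphere_zero_iff_norm.2 (by simp)⟩)

theorem refl_act (g : V ≃ₗᵢ[ℂ] V) (z : Circle) (y : Cover V) :
    refl z (y.act g).2.2 = g • refl z y.2.2 :=
  Subtype.ext (Subtype.ext (reflMap_smul g z y.2.2))

theorem Cover.proj_act (g : V ≃ₗᵢ[ℂ] V) (y : Cover V) : (y.act g).proj = g • y.proj :=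
  Prod.ext rfl (refl_act g y.2.1 y)

/-- The range of `T` is orthogonal to `e`. Applied to `T = excess α`, this says that `res_1` does
not see the angle `z`. -/
theorem refl_comp_eq_of_eq_smul {T : V →L[ℂ] V} {c : ℂ} (z : Circle)
    {e : Metric.sphere (0 : V) 1} (h : T = c • perpProj (e : V)) : (refl z e).1.1 ∘L T = T := by
  rw [coe_refl, h, ContinuousLinearMap.comp_smul, ContinuousLinearMap.sub_comp,
    ContinuousLinearMap.smul_comp, lineProj_comp_perpProj (norm_eq_of_mem_sphere e), smul_zero,
    sub_zero]
  rfl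

variable [FiniteDimensional ℂ V]

/-- The circle and the sphere are compact, so a triple goes to `∞` only if `α` does. -/
theorem Cover.tendsto_norm_inv : Tendsto
    (fun t : OnePoint (Cover V) => t.elim (0 : ℝ) fun y => (‖y.1.1‖ + 1)⁻¹) (𝓝 ∞) (𝓝 0) := by
  suffices h : ContinuousAt
      (fun t : OnePoint (Cover V) => t.elim (0 : ℝ) fun y => (‖y.1.1‖ + 1)⁻¹) ∞ from h
  refine OnePoint.continuousAt_infty'.2 ?_
  rw [coclosedCompact_eq_cocompact]
  have h1 : Tendsto (Prod.fst : Cover V → SelfAdj V) (cocompact _) (cocompact _) :=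
    (isProperMap_iff_tendsto_cocompact.1 isProperMap_fst_of_compactSpace).2
  exact tendsto_inv_atTop_zero.comp
    (tendsto_atTop_add_const_right _ 1 (tendsto_norm_cocompact_selfAdj.comp h1))

theorem Cover.isProperMap_proj : IsProperMap (Cover.proj : Cover V → _) := by
  refine isProperMap_of_comp_of_t2 ?_ continuous_fst isProperMap_fst_of_compactSpace
  exact continuous_fst.prodMk (continuous_refl.comp continuous_snd)

variable [hV : Fact (finrank ℂ V = 2)]

theorem Cover.proj_surjective : Function.Surjective (Cover.proj : Cover V → _) := by
  rintro ⟨α, φ⟩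
  obtain ⟨p, rfl⟩ := refl_surjective φ
  exact ⟨(α, p), rfl⟩

/-! ### The deviation of a triple from the complement of `A` -/

/-- The difference of `α - e_0(α)` and the multiple of the same norm of the projection onto the
complement of `e`. -/
def Cover.deviation (y : Cover V) : V →L[ℂ] V :=
  excess y.1 - (‖excess y.1‖ : ℂ) • perpProj (y.2.2 : V)

theorem Cover.deviation_isSymmetric (y : Cover V) :
    (y.deviation : V →ₗ[ℂ] V).IsSymmetric :=
  (excess_isSymmetric y.1).sub (real_smul_isSymmetric (perpProj_isSymmetric _) _)

theorem Cover.continuous_deviation : Continuous (Cover.deviation : Cover V → _) := by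
  have h1 : Continuous fun y : Cover V => excess y.1 := continuous_excess.comp continuous_fst
  have h2 : Continuous fun y : Cover V => perpProj (y.2.2 : V) :=
    continuous_perpProj.comp (continuous_subtype_val.comp (continuous_snd.comp continuous_snd))
  exact h1.sub ((Complex.continuous_ofReal.comp h1.norm).smul h2)

theorem Cover.deviation_act (g : V ≃ₗᵢ[ℂ] V) (y : Cover V) :
    (y.act g).deviation = conj g y.deviation := by
  rw [deviation, deviation, conj_sub, conj_smul, conj_perpProj]
  change excess (g • y.1) - (‖excess (g • y.1)‖ : ℂ) • perpProj (g y.2.2) = _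
  rw [excess_smul, norm_conj]

/-- By symmetry of `excess`, both conditions say that it kills `e`. -/
theorem lineProj_comp_excess_eq_zero_iff (y : Cover V) :
    lineProj (y.2.2 : V) ∘L excess y.1 = 0 ↔ y.deviation = 0 := by
  have he := norm_eq_of_mem_sphere y.2.2
  rw [Cover.deviation, sub_eq_zero]
  constructor
  · intro h
    refine excess_eq_of_apply_eq_zero _ he ?_
    have h1 : ∀ x, inner ℂ (y.2.2 : V) (excess y.1 x) = (0 : ℂ) := fun x => by
      have h2 := DFunLike.congr_fun h x
      have h3 : (y.2.2 : V) ≠ 0 := by rintro h0; simp [h0] at he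
      exact (smul_eq_zero_iff_left h3).1 h2
    rw [← inner_self_eq_zero (𝕜 := ℂ)]
    exact (excess_isSymmetric y.1 _ _).trans (h1 _)
  · intro h
    rw [h, ContinuousLinearMap.comp_smul, lineProj_comp_perpProj he, smul_zero]

theorem Cover.proj_mem_complA_iff (y : Cover V) :
    y.proj ∈ complA V 1 ↔ y.2.1 = 1 ∨ y.deviation = 0 := by
  rw [mem_complA_iff, ← lineProj_comp_excess_eq_zero_iff]
  change (1 - (1 - (y.2.1 : ℂ)) • lineProj (y.2.2 : V)) ∘L excess y.1 = excess y.1 ↔ _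
  rw [ContinuousLinearMap.sub_comp, ContinuousLinearMap.smul_comp, sub_eq_iff_eq_add]
  change excess y.1 = _ ↔ _
  rw [left_eq_add, smul_eq_zero, sub_eq_zero, eq_comm, Circle.coe_eq_one]

/-- Points of the space of triples with the same image in `X̃'_1` have the same image in
`s(V) × F_1`, unless they lie over the complement of `B`. -/
theorem Cover.eq_or_mem_complA {y y' : Cover V}
    (h : resUnbased 1 y.proj = resUnbased 1 y'.proj) :
    y.1 = y'.1 ∧ ((y.proj ∈ complA V 1 ∧ y'.proj ∈ complA V 1) ∨
      (lineProj (y.2.2 : V) = lineProj (y'.2.2 : V) ∧ y.2.1 = y'.2.1)) := by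
  have h1 : y.1 = y'.1 := congrArg XTilde.base h
  refine ⟨h1, ?_⟩
  by_cases hy : y.proj ∈ complA V 1
  · refine Or.inl ⟨hy, ?_⟩
    change resUnbased 1 y'.proj ∈ complB V 1
    rw [← h]
    exact hy
  · have h2 : (refl y.2.1 y.2.2).1.1 ∘L excess y.1 = (refl y'.2.1 y'.2.2).1.1 ∘L excess y.1 := by
      have := congrArg XTilde.endo h
      rw [endo_resUnbased, endo_resUnbased] at this
      change _ = _ ∘L excess y'.1 at this
      rwa [← h1] at this
    rw [proj_mem_complA_iff, not_or] at hy
    exact Or.inr (refl_eq_refl_iff _ hy.1 (mt (lineProj_comp_excess_eq_zero_iff y).1 hy.2) h2)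

/-! ### The homotopies -/

/-- The selfadjoint endomorphism obtained from `α` by moving it towards the line of matrices
`e_0(α) + t (1 - e e*)` and increasing its largest eigenvalue. -/
def Cover.push (s ρ : ℝ) (y : Cover V) : SelfAdj V :=
  ⟨y.1.1 + (((1 + ‖excess y.1‖) * (ρ⁻¹ - 1) : ℝ) : ℂ) • perpProj (y.2.2 : V) -
      clip (s * ‖1 - (y.2.1 : ℂ)‖) y.deviation,
    (y.1.2.add (real_smul_isSymmetric (perpProj_isSymmetric _) _)).sub
      (real_smul_isSymmetric y.deviation_isSymmetric _)⟩

theorem Cover.coe_push (s ρ : ℝ) (y : Cover V) : (y.push s ρ).1 =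
    y.1.1 + (((1 + ‖excess y.1‖) * (ρ⁻¹ - 1) : ℝ) : ℂ) • perpProj (y.2.2 : V) -
      clip (s * ‖1 - (y.2.1 : ℂ)‖) y.deviation := rfl

/-- The point of `(s(V) × F_1)_∞` at radius `ρ` and angle `ζ` over a triple. -/
def Cover.place (s ρ : ℝ) (ζ : Circle) (y : Cover V) : OnePoint (SelfAdj V × Filt V 1) :=
  if ρ = 0 then ∞ else ((y.push s ρ, refl ζ y.2.2) : SelfAdj V × Filt V 1)

theorem Cover.place_of_ne_zero {s ρ : ℝ} {ζ : Circle} {y : Cover V} (h : ρ ≠ 0) :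
    y.place s ρ ζ = ((y.push s ρ, refl ζ y.2.2) : SelfAdj V × Filt V 1) := if_neg h

/-- With `d = ‖excess y.1‖`, the coefficient `t` of the projection satisfies `1 + t = (1 + d)/ρ`. So
`ρ` is a radial coordinate: `ρ = 1` gives `t = d`, and `ρ → 0` gives `t → ∞` even when `d = 0`. -/
theorem Cover.coe_push_eq_add {s ρ : ℝ} {y : Cover V} : (y.push s ρ).1 =
    (lowEig y.1 : ℂ) • 1 +
      ((‖excess y.1‖ + (1 + ‖excess y.1‖) * (ρ⁻¹ - 1) : ℝ) : ℂ) • perpProj (y.2.2 : V) +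
      (y.deviation - clip (s * ‖1 - (y.2.1 : ℂ)‖) y.deviation) := by
  rw [coe_push, coe_eq_excess y.1, deviation, Complex.ofReal_add, add_smul]
  abel

theorem Cover.excess_push {s ρ : ℝ} {y : Cover V} (h0 : 0 ≤ ρ⁻¹ - 1)
    (h : clip (s * ‖1 - (y.2.1 : ℂ)‖) y.deviation = y.deviation) :
    excess (y.push s ρ) =
      ((‖excess y.1‖ + (1 + ‖excess y.1‖) * (ρ⁻¹ - 1) : ℝ) : ℂ) • perpProj (y.2.2 : V) := by
  refine excess_of_coe_eq (c := lowEig y.1) _ (by positivity) (norm_eq_of_mem_sphere y.2.2) ?_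
  rw [coe_push_eq_add, h, sub_self, add_zero]

theorem Cover.place_mem_complA {s ρ : ℝ} {ζ : Circle} {y : Cover V} (hρ0 : 0 ≤ ρ) (hρ : ρ ≤ 1)
    (h : clip (s * ‖1 - (y.2.1 : ℂ)‖) y.deviation = y.deviation) (hne : ρ ≠ 0) :
    (y.push s ρ, refl ζ y.2.2) ∈ complA V 1 := by
  have h0 : 0 ≤ ρ⁻¹ - 1 :=
    sub_nonneg.2 ((one_le_inv₀ (lt_of_le_of_ne hρ0 hne.symm)).2 hρ)
  rw [mem_complA_iff]
  exact refl_comp_eq_of_eq_smul ζ (excess_push h0 h)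

theorem Cover.push_one {s : ℝ} {y : Cover V} (h : y.proj ∈ complA V 1) : y.push s 1 = y.1 := by
  refine Subtype.ext ?_
  rw [coe_push]
  rcases (proj_mem_complA_iff y).1 h with h | h <;> simp [h]

theorem Cover.push_zero_one (y : Cover V) : y.push 0 1 = y.1 := by
  refine Subtype.ext ?_
  rw [coe_push]
  simp

theorem Cover.deviation_congr {y y' : Cover V} (h1 : y.1 = y'.1)
    (h2 : lineProj (y.2.2 : V) = lineProj (y'.2.2 : V)) : y.deviation = y'.deviation := by
  simp only [deviation, perpProj, h1, h2]

theorem Cover.place_congr {s ρ : ℝ} {ζ : Circle} {y y' : Cover V} (h1 : y.1 = y'.1)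
    (h2 : lineProj (y.2.2 : V) = lineProj (y'.2.2 : V)) (h3 : y.2.1 = y'.2.1) :
    y.place s ρ ζ = y'.place s ρ ζ := by
  have h4 : y.push s ρ = y'.push s ρ := by
    refine Subtype.ext ?_
    simp only [coe_push, deviation_congr h1 h2, perpProj, h1, h2, h3]
  have h5 : refl ζ y.2.2 = refl ζ y'.2.2 :=
    Subtype.ext (Subtype.ext (by rw [coe_refl, coe_refl, h2]))
  rw [place, place, h4, h5]

theorem Cover.place_act (g : V ≃ₗᵢ[ℂ] V) (s ρ : ℝ) (ζ : Circle) (y : Cover V) :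
    (y.act g).place s ρ ζ = g • y.place s ρ ζ := by
  have h : (y.act g).push s ρ = g • y.push s ρ := by
    refine Subtype.ext ?_
    rw [coe_push, deviation_act, SelfAdj.coe_smul, coe_push, conj_sub, conj_add, conj_smul,
      conj_clip, conj_perpProj]
    change _ + (((1 + ‖excess (g • y.1)‖) * (ρ⁻¹ - 1) : ℝ) : ℂ) • _ - _ = _
    rw [excess_smul, norm_conj]
    rfl
  rw [place, place, h, refl_act]
  split_ifs <;> rfl

/-- This estimate gives continuity at `∞`: the image is large if `α` is large or `ρ` small. For a
deviation of norm at least 2, `ρ = 1` and `α` moves by at most 2. Otherwise the image is within 2 of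
`M = e_0 + t(1 - ee*)`, where `|e_0| ≤ ‖M‖` (evaluate at `e`) and `t ≤ 2‖M‖`. -/
theorem Cover.le_norm_push {s ρ : ℝ} (hs0 : 0 ≤ s) (hs1 : s ≤ 1) (hρ0 : 0 < ρ) (hρ1 : ρ ≤ 1)
    {y : Cover V} (h : 2 ≤ ‖y.deviation‖ → ρ = 1) :
    ‖y.1.1‖ + ρ⁻¹ ≤ 3 * ‖(y.push s ρ).1‖ + 7 := by
  have ht : 0 ≤ s * ‖1 - (y.2.1 : ℂ)‖ := by positivity
  rcases le_or_gt 2 ‖y.deviation‖ with h2 | h2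
  · have h3 : ‖clip (s * ‖1 - (y.2.1 : ℂ)‖) y.deviation‖ ≤ 2 := by
      rw [norm_clip ht]
      refine (min_le_left _ _).trans ?_
      nlinarith [norm_one_sub_coe_le y.2.1, norm_nonneg (1 - (y.2.1 : ℂ))]
    have h4 : y.1.1 = (y.push s ρ).1 + clip (s * ‖1 - (y.2.1 : ℂ)‖) y.deviation := by
      rw [coe_push, h h2]; simp
    have h5 := norm_add_le (y.push s ρ).1 (clip (s * ‖1 - (y.2.1 : ℂ)‖) y.deviation)
    rw [← h4] at h5
    rw [h h2] at h5 ⊢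
    rw [inv_one]
    linarith [norm_nonneg (y.push s 1).1]
  · have hinv : 1 ≤ ρ⁻¹ := (one_le_inv₀ hρ0).2 hρ1
    set d := ‖excess y.1‖
    have hd : 0 ≤ d := norm_nonneg _
    have he := norm_eq_of_mem_sphere y.2.2
    set t := d + (1 + d) * (ρ⁻¹ - 1)
    have htd : d + ρ⁻¹ - 1 ≤ t := by
      have : 0 ≤ d * (ρ⁻¹ - 1) := mul_nonneg hd (by linarith)
      simp only [t]; linarith
    set M : V →L[ℂ] V := (lowEig y.1 : ℂ) • 1 + (t : ℂ) • perpProj (y.2.2 : V)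
    set R : V →L[ℂ] V := y.deviation - clip (s * ‖1 - (y.2.1 : ℂ)‖) y.deviation
    have hR : ‖R‖ ≤ 2 := (norm_sub_clip_le ht _).trans h2.le
    have hM : ‖M‖ ≤ ‖(y.push s ρ).1‖ + 2 := by
      have h3 : M = (y.push s ρ).1 - R := by
        rw [coe_push_eq_add]; simp only [M, R, t, d]; abel
      rw [h3]
      exact (norm_sub_le _ _).trans (by linarith)
    have h6 : |lowEig y.1| ≤ ‖M‖ := by
      have h7 := M.le_opNorm (y.2.2 : V)
      have h8 : M (y.2.2 : V) = (lowEig y.1 : ℂ) • (y.2.2 : V) := by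
        change (lowEig y.1 : ℂ) • (y.2.2 : V) + (t : ℂ) • perpProj (y.2.2 : V) y.2.2 = _
        rw [perpProj_apply, inner_self_of_norm_one he, one_smul, sub_self, smul_zero, add_zero]
      rwa [h8, norm_smul, he, mul_one, mul_one, Complex.norm_real, Real.norm_eq_abs] at h7
    have h9 : t ≤ ‖M‖ + |lowEig y.1| := by
      have h10 : (t : ℂ) • perpProj (y.2.2 : V) = M - (lowEig y.1 : ℂ) • 1 := by
        simp only [M]; abel
      have h11 : ‖(t : ℂ) • perpProj (y.2.2 : V)‖ = t := by
        rw [norm_smul, norm_perpProj he, mul_one, Complex.norm_of_nonneg (by linarith)]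
      rw [← h11, h10]
      refine (norm_sub_le _ _).trans (add_le_add_right ?_ _)
      rw [norm_smul, Complex.norm_real, Real.norm_eq_abs]
      exact mul_le_of_le_one_right (abs_nonneg _) ContinuousLinearMap.norm_id_le
    have h12 := norm_coe_le y.1
    linarith

/-- The extension of a map to the one-point compactification by `∞ ↦ ∞`. -/
def Cover.extend (F : I × Cover V → OnePoint (SelfAdj V × Filt V 1)) :
    I × OnePoint (Cover V) → OnePoint (SelfAdj V × Filt V 1) :=
  fun x => x.2.elim ∞ fun y => F (x.1, y)

theorem Cover.continuous_push {A : Type*} [TopologicalSpace A] {a₀ : A} {s ρ : A → ℝ}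
    {y : A → Cover V} (hs : Continuous s) (hs0 : ∀ a, 0 ≤ s a) (hρ : ContinuousAt ρ a₀)
    (hne : ρ a₀ ≠ 0) (hy : Continuous y) :
    ContinuousAt (fun a => (y a).push (s a) (ρ a)) a₀ := by
  refine IsInducing.subtypeVal.continuousAt_iff.2 ?_
  have h1 : Continuous fun a => (y a).1.1 := continuous_subtype_val.comp (continuous_fst.comp hy)
  have h2 : Continuous fun a => ‖excess (y a).1‖ :=
    (continuous_excess.comp (continuous_fst.comp hy)).norm
  have h3 : Continuous fun a => perpProj ((y a).2.2 : V) :=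
    continuous_perpProj.comp (continuous_subtype_val.comp
      (continuous_snd.comp (continuous_snd.comp hy)))
  have h4 : Continuous fun a => ((y a).2.1 : ℂ) :=
    continuous_subtype_val.comp (continuous_fst.comp (continuous_snd.comp hy))
  have h5 : Continuous fun a => clip (s a * ‖1 - ((y a).2.1 : ℂ)‖) (y a).deviation :=
    continuous_clip (hs.mul (continuous_const.sub h4).norm)
      (fun a => mul_nonneg (hs0 a) (norm_nonneg _)) (continuous_deviation.comp hy)
  have h6 : ContinuousAt (fun a => (1 + ‖excess (y a).1‖) * ((ρ a)⁻¹ - 1)) a₀ :=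
    (continuous_const.add h2).continuousAt.mul ((hρ.inv₀ hne).sub continuousAt_const)
  have h7 : ContinuousAt (fun a => (((1 + ‖excess (y a).1‖) * ((ρ a)⁻¹ - 1) : ℝ) : ℂ)) a₀ :=
    Complex.continuous_ofReal.continuousAt.comp h6
  have h8 : ContinuousAt (fun a => (((1 + ‖excess (y a).1‖) * ((ρ a)⁻¹ - 1) : ℝ) : ℂ) •
      perpProj ((y a).2.2 : V)) a₀ := h7.smul h3.continuousAt
  exact (h1.continuousAt.add h8).sub h5.continuousAt

/-- Near `∞`, and near points with `ρ = 0`, `Cover.le_norm_push` forces the image to `∞`, with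
weight `(‖α‖ + 1)⁻¹`, respectively `ρ`. Elsewhere the defining formulas are continuous, so the angle
matters only where `ρ ≠ 0`. -/
theorem Cover.continuous_extend {ρ : I × Cover V → ℝ} {ζ : I × Cover V → Circle}
    (hρ : Continuous ρ) (hρ0 : ∀ x, 0 ≤ ρ x) (hρ1 : ∀ x, ρ x ≤ 1)
    (hρ2 : ∀ x, 2 ≤ ‖x.2.deviation‖ → ρ x = 1) (hζ : ∀ x, ρ x ≠ 0 → ContinuousAt ζ x) :
    Continuous (extend fun x => x.2.place x.1 (ρ x) (ζ x)) := by
  have hN : Continuous fun x : SelfAdj V × Filt V 1 => 3 * ‖x.1.1‖ + 7 :=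
    (continuous_const.mul (continuous_subtype_val.comp continuous_fst).norm).add continuous_const
  have key (s : I) (y : Cover V) (x : SelfAdj V × Filt V 1)
      (h : y.place s (ρ (s, y)) (ζ (s, y)) = x) :
      0 < ρ (s, y) ∧ ‖y.1.1‖ + (ρ (s, y))⁻¹ ≤ 3 * ‖x.1.1‖ + 7 := by
    have h0 : ρ (s, y) ≠ 0 := by
      intro h0
      rw [place, if_pos h0] at h
      exact OnePoint.infty_ne_coe x h
    have h1 : 0 < ρ (s, y) := lt_of_le_of_ne (hρ0 _) h0.symm
    rw [place_of_ne_zero h0, OnePoint.coe_eq_coe] at h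
    rw [← h]
    exact ⟨h1, le_norm_push s.2.1 s.2.2 h1 (hρ1 _) (hρ2 (s, y))⟩
  refine continuous_iff_continuousAt.2 ?_
  rintro ⟨s, t⟩
  induction t using OnePoint.rec with
  | infty =>
    refine tendsto_infty_of_one_le_mul hN
      (w := fun x => x.2.elim (0 : ℝ) fun y => (‖y.1.1‖ + 1)⁻¹) ?_
      (tendsto_norm_inv.comp continuousAt_snd)
    rintro ⟨s', t'⟩ x hx
    induction t' using OnePoint.rec with
    | infty => exact absurd hx (OnePoint.infty_ne_coe x)
    | coe y =>
      obtain ⟨h1, h2⟩ := key s' y x hx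
      have h3 : 1 ≤ (ρ (s', y))⁻¹ := (one_le_inv₀ h1).2 (hρ1 _)
      have h4 : 0 < ‖y.1.1‖ + 1 := by positivity
      change 1 ≤ (‖y.1.1‖ + 1)⁻¹ * _
      rw [inv_mul_eq_div, one_le_div h4]
      linarith
  | coe y =>
    have hop : IsOpenEmbedding (Prod.map id (↑) : I × Cover V → I × OnePoint (Cover V)) :=
      IsOpenEmbedding.id.prodMap OnePoint.isOpenEmbedding_coe
    refine (hop.continuousAt_iff (x := (s, y))).1 ?_
    change ContinuousAt (fun x : I × Cover V => x.2.place x.1 (ρ x) (ζ x)) (s, y)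
    rcases eq_or_ne (ρ (s, y)) 0 with h0 | h0
    · have h1 : y.place s (ρ (s, y)) (ζ (s, y)) = ∞ := if_pos h0
      rw [ContinuousAt, h1]
      refine tendsto_infty_of_one_le_mul hN (w := ρ) ?_ (h0 ▸ hρ.continuousAt)
      rintro ⟨s', y'⟩ x hx
      obtain ⟨h1, h2⟩ := key s' y' x hx
      have h3 : (ρ (s', y'))⁻¹ ≤ 3 * ‖x.1.1‖ + 7 := by linarith [norm_nonneg y'.1.1]
      rwa [inv_le_iff_one_le_mul₀' h1] at h3
    · have h1 : ContinuousAt (fun x : I × Cover V =>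
          ((x.2.push x.1 (ρ x), refl (ζ x) x.2.2.2) : SelfAdj V × Filt V 1)) (s, y) := by
        have h2 : Continuous fun x : I × Cover V => (x.1 : ℝ) := by fun_prop
        have h3 : Continuous fun x : I × Cover V => x.2 := continuous_snd
        have h4 : ContinuousAt (fun x : I × Cover V => x.2.2.2) (s, y) :=
          (continuous_snd.comp (continuous_snd.comp h3)).continuousAt
        have h5 : ContinuousAt (fun x : I × Cover V => refl (ζ x) x.2.2.2) (s, y) :=
          continuousAt_refl (hζ _ h0) h4
        exact (continuous_push h2 (fun x => x.1.2.1) hρ.continuousAt h0 h3).prodMk h5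
      refine (OnePoint.continuous_coe.continuousAt.comp h1).congr ?_
      filter_upwards [hρ.continuousAt.eventually_ne h0] with x hx
      exact (place_of_ne_zero hx).symm

end

section

/-! ### The chord and radius homotopies and their behaviour on fibres -/

section Homotopies

variable {V : Type*} [NormedAddCommGroup V] [InnerProductSpace ℂ V]

theorem refl_one (e e' : Metric.sphere (0 : V) 1) : refl 1 e = refl 1 e' :=
  Subtype.ext (Subtype.ext (by simp [coe_refl]))

theorem eq_one_of_refl_eq {z' : Circle} {e e' : Metric.sphere (0 : V) 1}
    (h : refl 1 e = refl z' e') : z' = 1 := by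
  have h1 : (refl 1 e).1.1 = (refl z' e').1.1 := by rw [h]
  rw [coe_refl, coe_refl, sub_right_inj, Circle.coe_one, sub_self, zero_smul, eq_comm,
    smul_eq_zero, or_iff_left (lineProj_ne_zero (norm_eq_of_mem_sphere e')), sub_eq_zero] at h1
  exact Circle.coe_eq_one.1 h1.symm

variable [FiniteDimensional ℂ V] [hV : Fact (finrank ℂ V = 2)]

/-- The point on the segment from `1` to `z` at distance at most the norm of the deviation
from `1`. -/
def Cover.corner (y : Cover V) : ℂ := 1 - clip ‖y.deviation‖ (1 - (y.2.1 : ℂ))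

/-- The segment from `z` to `y.corner`. -/
def Cover.chord (s : ℝ) (y : Cover V) : ℂ := (1 - s) * y.2.1 + s * y.corner

/-- The segment from `1` to the norm of `y.corner`. -/
def Cover.radius (s : ℝ) (y : Cover V) : ℝ := 1 - s + s * ‖y.corner‖

theorem Cover.corner_of_mem_complA {y : Cover V} (h : y.proj ∈ complA V 1) : y.corner = 1 := by
  rcases (proj_mem_complA_iff y).1 h with h | h <;> simp [corner, h]

theorem Cover.radius_of_mem_complA {y : Cover V} (h : y.proj ∈ complA V 1) (s : ℝ) :
    y.radius s = 1 := by
  rw [radius, corner_of_mem_complA h]; simp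

theorem Cover.corner_of_le {y : Cover V} (h : ‖1 - (y.2.1 : ℂ)‖ ≤ ‖y.deviation‖) :
    y.corner = y.2.1 := by
  rw [corner, clip_of_norm_le h, sub_sub_cancel]

theorem Cover.chord_of_corner_eq {y : Cover V} (h : y.corner = y.2.1) (s : ℝ) :
    y.chord s = y.2.1 := by
  rw [chord, h]; ring

theorem Cover.norm_corner_le (y : Cover V) : ‖y.corner‖ ≤ 1 :=
  norm_one_sub_clip_le (norm_nonneg _) _

theorem Cover.norm_chord_le {s : ℝ} (hs0 : 0 ≤ s) (hs1 : s ≤ 1) (y : Cover V) :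
    ‖y.chord s‖ ≤ 1 := by
  refine (norm_add_le _ _).trans ?_
  have h1 : ‖(1 - (s : ℂ))‖ = 1 - s := by
    rw [← Complex.ofReal_one, ← Complex.ofReal_sub, Complex.norm_of_nonneg (by linarith)]
  rw [norm_mul, norm_mul, h1, Complex.norm_of_nonneg hs0, y.2.1.norm_coe]
  nlinarith [y.norm_corner_le]

theorem Cover.radius_nonneg {s : ℝ} (hs0 : 0 ≤ s) (hs1 : s ≤ 1) (y : Cover V) :
    0 ≤ y.radius s :=
  add_nonneg (sub_nonneg.2 hs1) (mul_nonneg hs0 (norm_nonneg _))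

theorem Cover.radius_le {s : ℝ} (hs0 : 0 ≤ s) (y : Cover V) : y.radius s ≤ 1 := by
  rw [radius]
  nlinarith [y.norm_corner_le]

theorem Cover.corner_congr {y y' : Cover V} (h1 : y.deviation = y'.deviation)
    (h2 : y.2.1 = y'.2.1) : y.corner = y'.corner := by
  rw [corner, corner, h1, h2]

theorem Cover.corner_act (g : V ≃ₗᵢ[ℂ] V) (y : Cover V) : (y.act g).corner = y.corner := by
  rw [corner, corner, deviation_act, norm_conj]
  rfl

theorem Cover.continuous_corner : Continuous (Cover.corner : Cover V → ℂ) := by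
  have h : Continuous fun y : Cover V => (y.2.1 : ℂ) :=
    continuous_subtype_val.comp (continuous_fst.comp continuous_snd)
  exact continuous_const.sub (continuous_clip continuous_deviation.norm
    (fun _ => norm_nonneg _) (continuous_const.sub h))

theorem Cover.continuous_chord : Continuous fun x : I × Cover V => x.2.chord x.1 := by
  have h : Continuous fun x : I × Cover V => (x.2.2.1 : ℂ) :=
    continuous_subtype_val.comp (continuous_fst.comp (continuous_snd.comp continuous_snd))
  have h1 : Continuous fun x : I × Cover V => ((x.1 : ℝ) : ℂ) :=
    Complex.continuous_ofReal.comp (continuous_subtype_val.comp continuous_fst)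
  exact ((continuous_const.sub h1).mul h).add (h1.mul (continuous_corner.comp continuous_snd))

theorem Cover.continuous_radius : Continuous fun x : I × Cover V => x.2.radius x.1 := by
  have h1 : Continuous fun x : I × Cover V => (x.1 : ℝ) :=
    continuous_subtype_val.comp continuous_fst
  exact (continuous_const.sub h1).add (h1.mul (continuous_corner.comp continuous_snd).norm)

/-- The first homotopy on triples: it contracts the circles over the complement of `B` inside the
discs formed by the multiples of the largest eigenvalue. -/
def slide (s : ℝ) (y : Cover V) : OnePoint (SelfAdj V × Filt V 1) :=
  y.place s ‖y.chord s‖ (direction (y.chord s))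

/-- The second homotopy on triples: it has the same effect on `s(V)` as the first one at the end,
but does not change the unitary map. -/
def stretch (s : ℝ) (y : Cover V) : OnePoint (SelfAdj V × Filt V 1) :=
  y.place s (y.radius s) y.2.1

theorem Cover.corner_of_two_le {y : Cover V} (h : 2 ≤ ‖y.deviation‖) : y.corner = y.2.1 :=
  corner_of_le ((norm_one_sub_coe_le _).trans h)

theorem continuous_extend_slide :
    Continuous (Cover.extend fun x : I × Cover V => slide x.1 x.2) := by
  refine Cover.continuous_extend Cover.continuous_chord.norm (fun _ => norm_nonneg _)
    (fun x => x.2.norm_chord_le x.1.2.1 x.1.2.2) (fun x hx => ?_) (fun x hx => ?_)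
  · rw [Cover.chord_of_corner_eq (Cover.corner_of_two_le hx), Circle.norm_coe]
  · have h1 := continuousAt_direction (norm_ne_zero_iff.1 hx)
    have h2 := Tendsto.comp h1 Cover.continuous_chord.continuousAt
    exact h2

theorem continuous_extend_stretch :
    Continuous (Cover.extend fun x : I × Cover V => stretch x.1 x.2) := by
  refine Cover.continuous_extend Cover.continuous_radius
    (fun x => x.2.radius_nonneg x.1.2.1 x.1.2.2) (fun x => x.2.radius_le x.1.2.1)
    (fun x hx => ?_) (fun x _ => ?_)
  · rw [Cover.radius, Cover.corner_of_two_le hx, Circle.norm_coe]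
    ring
  · exact (continuous_fst.comp (continuous_snd.comp continuous_snd)).continuousAt

theorem slide_zero (y : Cover V) : slide 0 y = y.proj := by
  have h : y.chord 0 = y.2.1 := by simp [Cover.chord]
  rw [slide, h, Circle.norm_coe, direction_coe, Cover.place_of_ne_zero one_ne_zero,
    Cover.push_zero_one]
  rfl

theorem stretch_zero (y : Cover V) : stretch 0 y = y.proj := by
  have h : y.radius 0 = 1 := by simp [Cover.radius]
  rw [stretch, h, Cover.place_of_ne_zero one_ne_zero, Cover.push_zero_one]
  rfl

theorem slide_congr {y y' : Cover V} (s : ℝ) (h1 : y.1 = y'.1)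
    (h2 : lineProj (y.2.2 : V) = lineProj (y'.2.2 : V)) (h3 : y.2.1 = y'.2.1) :
    slide s y = slide s y' := by
  have h : y.chord s = y'.chord s := by
    rw [Cover.chord, Cover.chord, Cover.corner_congr (Cover.deviation_congr h1 h2) h3, h3]
  rw [slide, slide, h, Cover.place_congr h1 h2 h3]

theorem stretch_congr {y y' : Cover V} (s : ℝ) (h1 : y.1 = y'.1)
    (h2 : lineProj (y.2.2 : V) = lineProj (y'.2.2 : V)) (h3 : y.2.1 = y'.2.1) :
    stretch s y = stretch s y' := by
  have h : y.radius s = y'.radius s := by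
    rw [Cover.radius, Cover.radius, Cover.corner_congr (Cover.deviation_congr h1 h2) h3]
  rw [stretch, stretch, h, h3, Cover.place_congr h1 h2 h3]

theorem slide_of_chord_eq_one {y : Cover V} {s : ℝ} (h : y.proj ∈ complA V 1)
    (h' : y.chord s = 1) : slide s y = ((y.1, refl 1 y.2.2) : SelfAdj V × Filt V 1) := by
  rw [slide, h', norm_one, Cover.place_of_ne_zero one_ne_zero, Cover.push_one h, direction_one]

/-- Here the radius stays 1, and nothing is clipped since `z = 1` or the deviation is zero. Being
stationary where `res_1` is not injective, `stretch` descends after composing with `res_1`. -/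
theorem stretch_of_mem_complA {y : Cover V} (s : ℝ) (h : y.proj ∈ complA V 1) :
    stretch s y = y.proj := by
  rw [stretch, Cover.radius_of_mem_complA h, Cover.place_of_ne_zero one_ne_zero, Cover.push_one h]
  rfl

/-- Apart from the phase of `e`, a triple is ambiguous only at `z = 1`, where `e` is arbitrary;
there the chord is the constant `1` and `α` does not move. -/
theorem slide_eq_of_proj_eq {y y' : Cover V} (s : ℝ) (h : y.proj = y'.proj) :
    slide s y = slide s y' := by
  obtain ⟨h1, h2⟩ := Prod.ext_iff.1 h
  change y.1 = y'.1 at h1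
  change refl y.2.1 y.2.2 = refl y'.2.1 y'.2.2 at h2
  by_cases hz : y.2.1 = 1
  · have hz' : y'.2.1 = 1 := eq_one_of_refl_eq (by rw [← h2, hz])
    have key (y : Cover V) (hz : y.2.1 = 1) :
        slide s y = ((y.1, refl 1 y.2.2) : SelfAdj V × Filt V 1) := by
      have h3 : y.proj ∈ complA V 1 := y.proj_mem_complA_iff.2 (Or.inl hz)
      refine slide_of_chord_eq_one h3 ?_
      rw [Cover.chord, Cover.corner_of_mem_complA h3, hz]
      simp
    rw [key y hz, key y' hz', h1, refl_one y.2.2 y'.2.2]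
  · obtain ⟨h3, h4⟩ := refl_eq_refl_iff (z := y.2.1) (z' := y'.2.1) (e := y.2.2) (e' := y'.2.2) 1 hz
      (lineProj_ne_zero (norm_eq_of_mem_sphere y.2.2)) (by rw [h2])
    exact slide_congr s h1 h3 h4

/-- Where `res_1` identifies different points, `corner = 1`, so `slide` ends at `(α, I)` for all of
them. -/
theorem slide_one_eq_of_resUnbased_eq {y y' : Cover V}
    (h : resUnbased 1 y.proj = resUnbased 1 y'.proj) : slide 1 y = slide 1 y' := by
  obtain ⟨h1, h2 | h2⟩ := Cover.eq_or_mem_complA h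
  · have key (y : Cover V) (h3 : y.proj ∈ complA V 1) :
        slide 1 y = ((y.1, refl 1 y.2.2) : SelfAdj V × Filt V 1) := by
      refine slide_of_chord_eq_one h3 ?_
      rw [Cover.chord, Cover.corner_of_mem_complA h3]
      simp
    rw [key y h2.1, key y' h2.2, h1, refl_one y.2.2 y'.2.2]
  · exact slide_congr 1 h1 h2.1 h2.2

theorem res_stretch_eq_of_resUnbased_eq {y y' : Cover V} (s : ℝ)
    (h : resUnbased 1 y.proj = resUnbased 1 y'.proj) :
    res 1 (stretch s y) = res 1 (stretch s y') := by
  obtain ⟨h1, h2 | h2⟩ := Cover.eq_or_mem_complA h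
  · rw [stretch_of_mem_complA s h2.1, stretch_of_mem_complA s h2.2]
    exact congrArg OnePoint.some h
  · rw [stretch_congr s h1 h2.1 h2.2]

theorem res_slide_one (y : Cover V) : res 1 (slide 1 y) = res 1 (stretch 1 y) := by
  have h1 : y.chord 1 = y.corner := by simp [Cover.chord]
  have h2 : y.radius 1 = ‖y.corner‖ := by simp [Cover.radius]
  rw [slide, stretch, h1, h2]
  rcases eq_or_ne ‖y.corner‖ 0 with h0 | h0
  · rw [Cover.place, Cover.place, if_pos h0, if_pos h0]
  rw [Cover.place_of_ne_zero h0, Cover.place_of_ne_zero h0]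
  refine congrArg OnePoint.some ?_
  -- Either the deviation is large and `corner = z`, so the angles agree, or the deviation is
  -- clipped away completely and both images carry the inclusion of `P_1`.
  rcases le_total ‖1 - (y.2.1 : ℂ)‖ ‖y.deviation‖ with h | h
  · rw [Cover.corner_of_le h, direction_coe]
  · have hc : clip (1 * ‖1 - (y.2.1 : ℂ)‖) y.deviation = y.deviation := by
      rw [one_mul, clip_of_norm_le h]
    have key (ζ : Circle) : (resUnbased 1 (y.push 1 ‖y.corner‖, refl ζ y.2.2)).endo =
        excess (y.push 1 ‖y.corner‖) :=
      (mem_complA_iff _).1 (Cover.place_mem_complA (norm_nonneg _) y.norm_corner_le hc h0)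
    exact XTilde.eq_of_endo_eq rfl ((key _).trans (key _).symm)

theorem slide_act (g : V ≃ₗᵢ[ℂ] V) (s : ℝ) (y : Cover V) :
    slide s (y.act g) = g • slide s y := by
  rw [slide, Cover.place_act, Cover.chord, Cover.corner_act]
  rfl

theorem stretch_act (g : V ≃ₗᵢ[ℂ] V) (s : ℝ) (y : Cover V) :
    stretch s (y.act g) = g • stretch s y := by
  rw [stretch, Cover.place_act, Cover.radius, Cover.corner_act]
  rfl

/-- If `z = 1` nothing moves. If the deviation is zero, the image keeps `e` as a lowest eigenvector
at every radius. -/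
theorem mem_complA_of_slide_eq {y : Cover V} {s : ℝ} (hs0 : 0 ≤ s) (hs1 : s ≤ 1)
    (h : y.proj ∈ complA V 1) {x : SelfAdj V × Filt V 1} (hx : slide s y = x) :
    x ∈ complA V 1 := by
  rcases y.proj_mem_complA_iff.1 h with h1 | h1
  · rw [slide_of_chord_eq_one h (by rw [Cover.chord, Cover.corner_of_mem_complA h, h1]; simp),
      OnePoint.coe_eq_coe] at hx
    rw [← hx, mem_complA_iff, coe_refl]
    ext v
    simp
  · have hne : ‖y.chord s‖ ≠ 0 := by
      intro h0
      rw [slide, Cover.place, if_pos h0] at hx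
      exact OnePoint.infty_ne_coe x hx
    rw [slide, Cover.place_of_ne_zero hne, OnePoint.coe_eq_coe] at hx
    rw [← hx]
    exact Cover.place_mem_complA (norm_nonneg _) (y.norm_chord_le hs0 hs1) (by simp [h1]) hne

end Homotopies

/-! ### The homotopy equivalences -/

section Main

variable {V : Type*} [NormedAddCommGroup V] [InnerProductSpace ℂ V] [FiniteDimensional ℂ V]
  [hV : Fact (finrank ℂ V = 2)] {G : Type*} [Group G] (ρ : G →* (V ≃ₗᵢ[ℂ] V))

variable (V) in
/-- The first homotopy, extended to the one-point compactification. -/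
def slideExt : I × OnePoint (Cover V) → OnePoint (SelfAdj V × Filt V 1) :=
  Cover.extend fun x => slide x.1 x.2

variable (V) in
/-- The second homotopy, extended to the one-point compactification. -/
def stretchExt : I × OnePoint (Cover V) → OnePoint (SelfAdj V × Filt V 1) :=
  Cover.extend fun x => stretch x.1 x.2

variable (V) in
/-- The surjection from triples, extended to the one-point compactification. -/
def projExt : OnePoint (Cover V) → OnePoint (SelfAdj V × Filt V 1) := OnePoint.map Cover.proj

theorem slideExt_zero (t : OnePoint (Cover V)) : slideExt V (0, t) = projExt V t := by
  induction t using OnePoint.rec with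
  | infty => rfl
  | coe y => exact slide_zero y

theorem stretchExt_zero (t : OnePoint (Cover V)) : stretchExt V (0, t) = projExt V t := by
  induction t using OnePoint.rec with
  | infty => rfl
  | coe y => exact stretch_zero y

theorem slideExt_eq_of_projExt_eq (s : I) (t t' : OnePoint (Cover V))
    (h : projExt V t = projExt V t') : slideExt V (s, t) = slideExt V (s, t') := by
  induction t using OnePoint.rec <;> induction t' using OnePoint.rec
  · rfl
  · exact absurd h (OnePoint.infty_ne_coe _)
  · exact absurd h (OnePoint.coe_ne_infty _)
  · exact slide_eq_of_proj_eq s (OnePoint.coe_injective h)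

theorem slideExt_one_eq_of_res_eq (t t' : OnePoint (Cover V))
    (h : res 1 (projExt V t) = res 1 (projExt V t')) :
    slideExt V (1, t) = slideExt V (1, t') := by
  induction t using OnePoint.rec <;> induction t' using OnePoint.rec
  · rfl
  · exact absurd h (OnePoint.infty_ne_coe _)
  · exact absurd h (OnePoint.coe_ne_infty _)
  · exact slide_one_eq_of_resUnbased_eq (OnePoint.coe_injective h)

theorem res_stretchExt_eq_of_res_eq (s : I) (t t' : OnePoint (Cover V))
    (h : res 1 (projExt V t) = res 1 (projExt V t')) :
    res 1 (stretchExt V (s, t)) = res 1 (stretchExt V (s, t')) := by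
  induction t using OnePoint.rec <;> induction t' using OnePoint.rec
  · rfl
  · exact absurd h (OnePoint.infty_ne_coe _)
  · exact absurd h (OnePoint.coe_ne_infty _)
  · exact res_stretch_eq_of_resUnbased_eq s (OnePoint.coe_injective h)

theorem res_slideExt_one (t : OnePoint (Cover V)) :
    res 1 (slideExt V (1, t)) = res 1 (stretchExt V (1, t)) := by
  induction t using OnePoint.rec with
  | infty => rfl
  | coe y => exact res_slide_one y

theorem isBasedGHomotopyEquiv_res : IsBasedGHomotopyEquiv ρ (res (V := V) 1) := by
  refine isBasedGHomotopyEquiv_of_homotopies ρ (res 1) (projExt V) (slideExt V) (stretchExt V)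
    (continuous_onePointMap isProperMap_resUnbased)
    (onePointMap_surjective resUnbased_surjective) rfl (fun g x => ?_)
    (continuous_onePointMap Cover.isProperMap_proj) (onePointMap_surjective Cover.proj_surjective)
    continuous_extend_slide continuous_extend_stretch slideExt_zero stretchExt_zero
    slideExt_eq_of_projExt_eq slideExt_one_eq_of_res_eq res_stretchExt_eq_of_res_eq
    res_slideExt_one ⟨∞, rfl, fun _ => ⟨rfl, rfl⟩⟩ (fun g t => ?_)
  · induction x using OnePoint.rec with
    | infty => rfl
    | coe x => exact congrArg OnePoint.some (resUnbased_smul (ρ g) x)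
  · induction t using OnePoint.rec with
    | infty => exact ⟨∞, rfl, fun _ => ⟨rfl, rfl⟩⟩
    | coe y =>
      exact ⟨(y.act (ρ g) : Cover V), congrArg OnePoint.some (Cover.proj_act (ρ g) y),
        fun s => ⟨slide_act (ρ g) s y, stretch_act (ρ g) s y⟩⟩

/-- The part of the space of triples which lies over the complement of `A`. -/
abbrev coverComplA (V : Type*) [NormedAddCommGroup V] [InnerProductSpace ℂ V]
    [FiniteDimensional ℂ V] : Set (Cover V) := {y | y.proj ∈ complA V 1}

/-- The homotopies for `res_1` are restricted to the triples over the complement of `A`; each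
required identity is checked after the closed embeddings `iX` and `iZ`. -/
theorem isBasedGHomotopyEquiv_res' : IsBasedGHomotopyEquiv ρ (res' (V := V) 1) := by
  have hcl : IsClosed (coverComplA V) := isClosed_complA.preimage Cover.isProperMap_proj.continuous
  let iT : OnePoint (coverComplA V) → OnePoint (Cover V) := OnePoint.map Subtype.val
  let iX : OnePoint (complA V 1) → OnePoint (SelfAdj V × Filt V 1) := OnePoint.map Subtype.val
  let iZ : OnePoint (complB V 1) → OnePoint (XTilde V 1) := OnePoint.map Subtype.val
  have hiT : IsClosedEmbedding iT := isClosedEmbedding_onePointMap_val hcl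
  have hiX : IsClosedEmbedding iX := isClosedEmbedding_onePointMap_val isClosed_complA
  have hiZ : IsClosedEmbedding iZ := isClosedEmbedding_onePointMap_val isClosed_complB
  have : T2Space (OnePoint (complA V 1)) := hiX.isEmbedding.t2Space
  have : T2Space (OnePoint (complB V 1)) := hiZ.isEmbedding.t2Space
  have hmem (x : OnePoint (SelfAdj V × Filt V 1)) :
      x ∈ range iX ↔ ∀ y : SelfAdj V × Filt V 1, x = y → y ∈ complA V 1 :=
    mem_range_onePointMap_val (S := (complA V 1 : Set (SelfAdj V × Filt V 1)))
  have hiXG (g : G) (x) : iX (ρ g • x) = ρ g • iX x := by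
    induction x using OnePoint.rec <;> rfl
  have hiZG (g : G) (x) : iZ (ρ g • x) = ρ g • iZ x := by
    induction x using OnePoint.rec <;> rfl
  have hres (x) : iZ (res' 1 x) = res 1 (iX x) := by
    induction x using OnePoint.rec <;> rfl
  let p : OnePoint (coverComplA V) → OnePoint (complA V 1) :=
    OnePoint.map fun y => ⟨y.1.proj, y.2⟩
  have hp (t) : iX (p t) = projExt V (iT t) := by
    induction t using OnePoint.rec <;> rfl
  have hcont : Continuous (Prod.map id iT : I × _ → I × _) :=
    continuous_id.prodMap hiT.continuous
  -- On these triples both homotopies stay in the complement of `A`, so they factor through `iX`.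
  obtain ⟨H, hH, hHi⟩ := exists_lift_of_isEmbedding hiX.isEmbedding
    (continuous_extend_slide.comp hcont) (fun ⟨s, t⟩ => by
      rw [hmem]
      intro x hx
      induction t using OnePoint.rec with
      | infty => exact absurd hx (OnePoint.infty_ne_coe x)
      | coe y => exact mem_complA_of_slide_eq s.2.1 s.2.2 y.2 hx)
  replace hHi (s t) : iX (H (s, t)) = slideExt V (s, iT t) := hHi (s, t)
  obtain ⟨K, hK, hKi⟩ := exists_lift_of_isEmbedding hiX.isEmbedding
    (continuous_extend_stretch.comp hcont) (fun ⟨s, t⟩ => by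
      rw [hmem]
      intro x hx
      induction t using OnePoint.rec with
      | infty => exact absurd hx (OnePoint.infty_ne_coe x)
      | coe y =>
        have h := (stretch_of_mem_complA s y.2).symm.trans hx
        exact OnePoint.coe_injective h ▸ y.2)
  replace hKi (s t) : iX (K (s, t)) = stretchExt V (s, iT t) := hKi (s, t)
  have hf (t t' : OnePoint (coverComplA V)) (h : res' 1 (p t) = res' 1 (p t')) :
      res 1 (projExt V (iT t)) = res 1 (projExt V (iT t')) := by
    rw [← hp, ← hp, ← hres, ← hres, h]
  refine isBasedGHomotopyEquiv_of_homotopies ρ (res' 1) p H K ?_ (onePointMap_surjective ?_) rfl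
    (fun g x => hiZ.injective ?_) ?_ (onePointMap_surjective ?_) hH hK
    (fun t => hiX.injective ?_) (fun t => hiX.injective ?_)
    (fun s t t' h => hiX.injective ?_) (fun t t' h => hiX.injective ?_)
    (fun s t t' h => hiZ.injective ?_) (fun t => hiZ.injective ?_)
    ⟨∞, rfl, fun s => ⟨hiX.injective ?_, hiX.injective ?_⟩⟩ (fun g t => ?_)
  · refine hiZ.isEmbedding.continuous_iff.2 ?_
    have h : iZ ∘ res' 1 = res 1 ∘ iX := funext hres
    rw [h]
    exact (continuous_onePointMap isProperMap_resUnbased).comp hiX.continuous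
  · rintro ⟨x, hx⟩
    obtain ⟨a, rfl⟩ := resUnbased_surjective x
    exact ⟨⟨a, hx⟩, rfl⟩
  · have hG (x : OnePoint (SelfAdj V × Filt V 1)) : res 1 (ρ g • x) = ρ g • res 1 x := by
      induction x using OnePoint.rec with
      | infty => rfl
      | coe x => exact congrArg OnePoint.some (resUnbased_smul (ρ g) x)
    rw [hres, hiXG, hiZG, hres, hG]
  · refine hiX.isEmbedding.continuous_iff.2 ?_
    have h : iX ∘ p = projExt V ∘ iT := funext hp
    rw [h]
    exact (continuous_onePointMap Cover.isProperMap_proj).comp hiT.continuous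
  · rintro ⟨x, hx⟩
    obtain ⟨a, rfl⟩ := Cover.proj_surjective x
    exact ⟨⟨a, hx⟩, rfl⟩
  · rw [hHi, hp, slideExt_zero]
  · rw [hKi, hp, stretchExt_zero]
  · rw [hHi, hHi]
    exact slideExt_eq_of_projExt_eq s _ _ (by rw [← hp, ← hp, h])
  · rw [hHi, hHi]
    exact slideExt_one_eq_of_res_eq _ _ (hf t t' h)
  · rw [hres, hres, hKi, hKi]
    exact res_stretchExt_eq_of_res_eq s _ _ (hf t t' h)
  · rw [hres, hres, hKi, hHi, res_slideExt_one]
  · exact hHi s ∞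
  · exact hKi s ∞
  · induction t using OnePoint.rec with
    | infty =>
      exact ⟨∞, rfl, fun s => ⟨hiX.injective (by rw [hiXG, hHi]; rfl),
        hiX.injective (by rw [hiXG, hKi]; rfl)⟩⟩
    | coe y =>
      have hy : y.1.act (ρ g) ∈ coverComplA V := by
        change Cover.proj _ ∈ complA V 1
        rw [Cover.proj_act]
        exact (complA V 1).smul_mem _ y.2
      refine ⟨((⟨y.1.act (ρ g), hy⟩ : coverComplA V) : OnePoint (coverComplA V)),
        hiX.injective ?_, fun s => ⟨hiX.injective ?_, hiX.injective ?_⟩⟩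
      · rw [hp, hiXG, hp]
        exact congrArg OnePoint.some (Cover.proj_act (ρ g) y.1)
      · rw [hHi, hiXG, hHi]
        exact slide_act (ρ g) s y.1
      · rw [hKi, hiXG, hKi]
        exact stretch_act (ρ g) s y.1

end Main

end

end MillerTower

end

theorem mainTheorem6 {V : Type*} [NormedAddCommGroup V] [InnerProductSpace ℂ V]
    [FiniteDimensional ℂ V] (hV : Module.finrank ℂ V = 2)
    {G : Type*} [Group G] (ρ : G →* (V ≃ₗᵢ[ℂ] V)) :
    MillerTower.IsBasedGHomotopyEquiv ρ
        (MillerTower.res' (V := V) 1) ∧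
      MillerTower.IsBasedGHomotopyEquiv ρ
        (MillerTower.res (V := V) 1) := by
  have : Fact (Module.finrank ℂ V = 2) := ⟨hV⟩
  exact ⟨MillerTower.isBasedGHomotopyEquiv_res' ρ, MillerTower.isBasedGHomotopyEquiv_res ρ⟩
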